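/- A finite simple graph $\mathcal{G}$ is called a $(b,d)$-expander if its maximum degree is $d$ and, for every set $S\subset V(\mathcal{G})$ of at most $|V(\mathcal{G})|/2$ vertices, there are at least $b|S|$ edges of $\mathcal{G}$ between $S$ and $V(\mathcal{G})\setminus S$. For $0<p<1$ let $\mathcal{G}_p$ denote bond percolation on $\mathcal{G}$, i.e., the random spanning subgraph of $\mathcal{G}$ in which each edge of $\mathcal{G}$ is present, independently, with probability $p$. For a graph $G$ and a vertex $v$, let $\mathcal{C}_v(G)$ be the connected component of $v$ in $G$, and let $\operatorname{diam}$ denote the diameter of a connected graph (with respect to its own graph distance). Theorem. For every $\epsilon>0$ and $0<p<1$ there exist a real $b>0$, an integer $d>0$ and a real $\delta>0$ such that, for infinitely many values of $n$, there are a $(b,d)$-expander $\mathcal{G}=\mathcal{G}^{(n)}$ on $n$ vertices and a vertex $v=v^{(n)}$ of $\mathcal{G}$ for which the random graph $G\sim\mathcal{G}_p$ satisfies $$\mathbb{P}\big(\operatorname{diam}(\mathcal{C}_v(G))\ge (1-\epsilon)\operatorname{diam}(\mathcal{G})\big)\ge 1-\epsilon ,$$ and yet, with probability tending to $1$ as $n\to\infty$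 along these values of $n$, no connected component of $G$ has more than $n^{1-\delta}$ vertices. -/

import Mathlib

open MeasureTheory ProbabilityTheory Filter Topology

/-- A finite graph `G` is a `(b, d)`-expander if its maximum degree is `d` and every set `S` of at
most half of the vertices has at least `b * |S|` edges between `S` and its complement.
(`G.interedges S Sᶜ` lists each edge of the cut once, as the pair whose first entry is in `S`.) -/
def IsExpander {V : Type*} [Fintype V] [DecidableEq V] (G : SimpleGraph V) [DecidableRel G.Adj]
    (b : ℝ) (d : ℕ) : Prop :=
  G.maxDegree = d ∧
    ∀ S : Finset V, (S.card : ℝ) ≤ (Fintype.card V : ℝ) / 2 →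
      b * (S.card : ℝ) ≤ ((G.interedges S Sᶜ).card : ℝ)

/-- Bond percolation on `G`: the law of the random spanning subgraph of `G` in which each edge of
`G` is present, independently, with probability `p`. -/
noncomputable def percolation {V : Type*} (G : SimpleGraph V) (p : unitInterval) :
    Measure (SimpleGraph V) :=
  (setBernoulli G.edgeSet p).map SimpleGraph.fromEdgeSet

instance percolation_isProbabilityMeasure {V : Type*} [Countable V] (G : SimpleGraph V)
    (p : unitInterval) : IsProbabilityMeasure (percolation G p) :=
  Measure.isProbabilityMeasure_map SimpleGraph.measurable_fromEdgeSet.aemeasurable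

/-- The connected component of the vertex `v` in `H`, as a graph on its own vertex set. -/
abbrev componentGraph {V : Type*} (H : SimpleGraph V) (v : V) :
    SimpleGraph (H.connectedComponentMk v) :=
  (H.connectedComponentMk v).toSimpleGraph

/-! The graph combines an expander whose edges are so long that percolation shatters it with a
stretched binary tree that percolation crosses, the tree being longer than the diameter of the
whole.

Host: eight expanding permutations of a set `Y` of 17^(6t) points give a bounded degree expander
(`exists_expanding_perms`). Each of its edges is subdivided into 2K+3 edges, which costs only a
constant factor in the expansion (`hostGraph_expansion`) and leaves the diameter at most Lt for a
constant L (`hostGraph_ediam_le`). Each point also carries a pendant path with a free tip: the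
letter `none` is its own opposite and encodes the identity, so the exit of its leg is a loop, which
is dropped.

Tree: a binary tree of depth t, each edge replaced by M parallel paths of length L+2, has its
vertices identified with free tips that are far apart in the expander. Added edges preserve the
expansion and cannot increase the diameter. For large M each bundle contains an open path with
probability near 1, so the root is joined to the top level with probability near 1
(`le_measureReal_reach_top`).

An open host path gets past a point of `Y` only along a completely open leg. For large K, except
with probability 17^(-t), no t distinct points with such a leg lie on a path of the expander
(`measureReal_hasBadPath_le`). Open host clusters then lie over word balls of radius t+1
(`mem_wordBall_of_reachable`), and this has two consequences. No host excursion joins two tree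
vertices, so open paths from the root to the top have length at least (L+2)t, which exceeds the
diameter (`level_le_of_walk`). And a component is covered by one such cluster per tree vertex and
one more, so it has at most 17^(3t) ≤ √n vertices (`ncard_reachable_le`). -/

/-! ### Bond percolation: edge independence, atoms, relabelling. -/

section Percolation
variable {V : Type*}

instance discreteMeasurableSpace_simpleGraph [Finite V] :
    DiscreteMeasurableSpace (SimpleGraph V) where
  forall_measurableSet S := by
    refine ⟨SimpleGraph.Adj '' S, MeasurableSet.of_discrete, ?_⟩
    exact Set.preimage_image_eq _ fun G H h => SimpleGraph.ext h

lemma setBernoulli_forall_mem {ι : Type*} [Countable ι] (u : Set ι) (p : unitInterval)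
    (s : Finset ι) [DecidablePred (· ∈ u)] :
    setBernoulli u p {ω | ∀ i ∈ s, i ∈ ω} =
      ∏ i ∈ s, if i ∈ u then (unitInterval.toNNReal p : ENNReal) else 0 := by
  rw [setBernoulli_apply']
  have : ((fun p : ι → Prop ↦ {i | p i}) ⁻¹' {ω | ∀ i ∈ s, i ∈ ω}) =
      (s : Set ι).pi fun _ => {True} := by
    ext f; simp
  rw [this, Measure.infinitePi_pi _ (by simp)]
  refine Finset.prod_congr rfl fun i _ => ?_
  by_cases hi : i ∈ u <;> simp [hi]

open Classical in
lemma percolation_forall_mem [Finite V] (G : SimpleGraph V) (p : unitInterval)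
    (s : Finset (Sym2 V)) :
    percolation G p {H | ∀ e ∈ s, e ∈ H.edgeSet} =
      ∏ e ∈ s, if e ∈ G.edgeSet then (unitInterval.toNNReal p : ENNReal) else 0 := by
  rw [percolation, Measure.map_apply SimpleGraph.measurable_fromEdgeSet .of_discrete]
  by_cases hs : ∀ e ∈ s, ¬ e.IsDiag
  · rw [← setBernoulli_forall_mem]
    congr 1
    ext ω
    simp only [Set.mem_preimage, Set.mem_ofPred_eq, SimpleGraph.edgeSet_fromEdgeSet]
    exact forall₂_congr fun e he => ⟨fun h => h.1, fun h => ⟨h, hs e he⟩⟩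
  -- `fromEdgeSet` discards diagonal pairs, and these are not edges of `G` either, so both sides
  -- vanish.
  · push Not at hs
    obtain ⟨e, he, hd⟩ := hs
    rw [Finset.prod_eq_zero he, measure_eq_zero_iff_ae_notMem.2]
    · refine ae_of_all _ fun ω hω => ?_
      simp only [Set.mem_preimage, Set.mem_ofPred_eq, SimpleGraph.edgeSet_fromEdgeSet] at hω
      exact (hω e he).2 hd
    · exact if_neg fun h => SimpleGraph.not_isDiag_of_mem_edgeSet _ h hd

lemma percolation_real_forall_mem [Finite V] (G : SimpleGraph V) (p : unitInterval)
    (s : Finset (Sym2 V)) (hs : ∀ e ∈ s, e ∈ G.edgeSet) :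
    (percolation G p).real {H | ∀ e ∈ s, e ∈ H.edgeSet} = (p : ℝ) ^ s.card := by
  classical
  rw [measureReal_def, percolation_forall_mem, Finset.prod_congr rfl fun e he => if_pos (hs e he)]
  simp

lemma percolation_iIndepSet [Finite V] (G : SimpleGraph V) (p : unitInterval) :
    iIndepSet (fun e : Sym2 V => {H : SimpleGraph V | e ∈ H.edgeSet}) (percolation G p) := by
  classical
  rw [iIndepSet_iff_meas_biInter fun _ => .of_discrete]
  intro s
  have h1 : ∀ e : Sym2 V, percolation G p {H | e ∈ H.edgeSet} =
      if e ∈ G.edgeSet then (unitInterval.toNNReal p : ENNReal) else 0 := by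
    intro e
    simpa using percolation_forall_mem G p {e}
  rw [Finset.prod_congr rfl fun e _ => h1 e, ← percolation_forall_mem]
  congr 1
  ext H
  simp

lemma percolation_ae_le [Finite V] (G : SimpleGraph V) (p : unitInterval) :
    ∀ᵐ H ∂percolation G p, H ≤ G := by
  rw [percolation, ae_map_iff SimpleGraph.measurable_fromEdgeSet.aemeasurable .of_discrete]
  filter_upwards [setBernoulli_ae_subset (u := G.edgeSet) (p := p)] with ω hω
  intro a b hab
  exact hω ((SimpleGraph.fromEdgeSet_adj _).1 hab).1

-- The vertex set being finite, the law is determined by its atoms; this reduces relabelling to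
-- counting present and absent edges.
open Classical in
lemma percolation_singleton [Finite V] (G H : SimpleGraph V) (p : unitInterval) :
    percolation G p {H} = if H ≤ G then (unitInterval.toNNReal p : ENNReal) ^ H.edgeSet.ncard *
      (unitInterval.toNNReal (unitInterval.symm p) : ENNReal) ^ (G.edgeSet \ H.edgeSet).ncard
      else 0 := by
  have h1 : percolation G p {H} = setBernoulli G.edgeSet p {H.edgeSet} := by
    rw [percolation, Measure.map_apply SimpleGraph.measurable_fromEdgeSet .of_discrete]
    refine measure_congr ?_
    filter_upwards [setBernoulli_ae_subset (u := G.edgeSet) (p := p)] with ω hω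
    refine propext ⟨fun h => ?_, fun h => ?_⟩
    · have h' : SimpleGraph.fromEdgeSet ω = H := h
      change ω = H.edgeSet
      rw [← h', SimpleGraph.edgeSet_fromEdgeSet]
      exact (sdiff_eq_left.2 (Set.disjoint_left.2 fun e he hd =>
        SimpleGraph.not_isDiag_of_mem_edgeSet _ (hω he) hd)).symm
    · have h' : ω = H.edgeSet := h
      change SimpleGraph.fromEdgeSet ω = H
      rw [h', SimpleGraph.fromEdgeSet_edgeSet]
  rw [h1]
  split_ifs with h
  · exact setBernoulli_singleton p (SimpleGraph.edgeSet_subset_edgeSet.2 h) (Set.toFinite _)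
  · exact setBernoulli_singleton_of_not_subset p (mt SimpleGraph.edgeSet_subset_edgeSet.1 h)

/-- Percolation commutes with relabelling of the vertices. -/
lemma percolation_real_map_equiv {W : Type*} [Finite V] [Finite W] (f : V ≃ W) (G : SimpleGraph V)
    (p : unitInterval) (A : Set (SimpleGraph W)) :
    (percolation (G.map f) p).real A = (percolation G p).real {H | H.map f ∈ A} := by
  classical
  change (percolation (G.map f.toEmbedding) p).real A =
    (percolation G p).real {H | H.map f.toEmbedding ∈ A}
  have hsurj : Function.Surjective fun H : SimpleGraph V => H.map f.toEmbedding := fun H =>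
    ⟨H.map f.symm.toEmbedding, by
      ext a b
      simp⟩
  have key : percolation (G.map f.toEmbedding) p =
      (percolation G p).map fun H => H.map f.toEmbedding := by
    refine Measure.ext_of_singleton fun H' => ?_
    obtain ⟨H, rfl⟩ := hsurj H'
    rw [Measure.map_apply .of_discrete .of_discrete]
    have h2 : (fun H : SimpleGraph V => H.map f.toEmbedding) ⁻¹' {H.map f.toEmbedding} = {H} := by
      ext K
      exact (SimpleGraph.map_injective f.toEmbedding).eq_iff
    rw [h2, percolation_singleton, percolation_singleton]
    have hinj : Function.Injective (Sym2.map f) := Sym2.map.injective f.injective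
    have h3 : ∀ K : SimpleGraph V, (K.map f.toEmbedding).edgeSet = Sym2.map f '' K.edgeSet :=
      fun K => SimpleGraph.edgeSet_map f.toEmbedding K
    rw [h3, h3, ← Set.image_sdiff hinj, Set.ncard_image_of_injective _ hinj,
      Set.ncard_image_of_injective _ hinj]
    have h4 : H.map f.toEmbedding ≤ G.map f.toEmbedding ↔ H ≤ G := by
      rw [SimpleGraph.map_le_iff_le_comap, SimpleGraph.comap_map_eq]
    simp only [h4]
  rw [key, measureReal_def, measureReal_def, Measure.map_apply .of_discrete .of_discrete]
  rfl
end Percolation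

/-! ### Independent families of events and survival in a binary tree. -/

section Independence
variable {Ω ι : Type*} {s : ι → Set Ω}

/-- The σ-algebra generated by the events `s i`, `i ∈ S`. -/
abbrev eventSigma (s : ι → Set Ω) (S : Set ι) : MeasurableSpace Ω :=
  MeasurableSpace.generateFrom {t | ∃ i ∈ S, s i = t}

lemma eventSigma_mono {S T : Set ι} (h : S ⊆ T) : eventSigma s S ≤ eventSigma s T :=
  MeasurableSpace.generateFrom_mono fun _ ⟨i, hi, hit⟩ => ⟨i, h hi, hit⟩

lemma measurableSet_eventSigma {S : Set ι} {i : ι} (hi : i ∈ S) :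
    MeasurableSet[eventSigma s S] (s i) :=
  MeasurableSpace.measurableSet_generateFrom ⟨i, hi, rfl⟩

/-- In the binary tree whose node `x` has children `2 * x` and `2 * x + 1`, the event that some
descendant `n` generations below `x` is joined to `x` by a chain of links, where `link y` is the
link from `y` to its parent. -/
def survives (link : ℕ → Set Ω) : ℕ → ℕ → Set Ω
  | 0, _ => Set.univ
  | n + 1, x => (link (2 * x) ∩ survives link n (2 * x)) ∪
      (link (2 * x + 1) ∩ survives link n (2 * x + 1))

/-- Only links of proper descendants (1 ≤ k) enter, which keeps survival below `x` independent of
the link above `x`. -/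
lemma measurableSet_survives {F : ℕ → Set ι} {link : ℕ → Set Ω}
    (hl : ∀ x, MeasurableSet[eventSigma s (F x)] (link x)) (n x : ℕ) :
    MeasurableSet[eventSigma s (⋃ y ∈ {y | ∃ k, 1 ≤ k ∧ y / 2 ^ k = x}, F y)]
      (survives link n x) := by
  induction n generalizing x with
  | zero => exact MeasurableSet.univ
  | succ n ih =>
    have key : ∀ z, z / 2 = x → MeasurableSet[eventSigma s
        (⋃ y ∈ {y | ∃ k, 1 ≤ k ∧ y / 2 ^ k = x}, F y)] (link z ∩ survives link n z) := by
      intro z hz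
      refine MeasurableSet.inter ?_ ?_
      · refine eventSigma_mono ?_ _ (hl z)
        exact Set.subset_biUnion_of_mem (u := F) (show z ∈ {y | ∃ k, 1 ≤ k ∧ y / 2 ^ k = x} from
          ⟨1, le_rfl, by simpa using hz⟩)
      · refine eventSigma_mono ?_ _ (ih z)
        refine Set.biUnion_subset_biUnion_left ?_
        rintro y ⟨k, hk, hy⟩
        exact ⟨k + 1, by omega, by rw [pow_succ, ← Nat.div_div_eq_div_mul, hy, hz]⟩
    exact (key _ (by omega)).union (key _ (by omega))

variable [MeasurableSpace Ω] {μ : Measure Ω}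

lemma eventSigma_le (hsm : ∀ i, MeasurableSet (s i)) (S : Set ι) :
    eventSigma s S ≤ ‹MeasurableSpace Ω› :=
  MeasurableSpace.generateFrom_le fun _ ⟨i, _, hit⟩ => hit ▸ hsm i

lemma measureReal_inter_of_disjoint (hsm : ∀ i, MeasurableSet (s i)) (hs : iIndepSet s μ)
    {S T : Set ι} (hST : Disjoint S T) {E F : Set Ω} (hE : MeasurableSet[eventSigma s S] E)
    (hF : MeasurableSet[eventSigma s T] F) : μ.real (E ∩ F) = μ.real E * μ.real F := by
  have := (Indep_iff _ _ μ).1 (hs.indep_generateFrom_of_disjoint hsm S T hST) E F hE hF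
  simp [measureReal_def, this]

lemma measureReal_biInter_of_disjoint [IsProbabilityMeasure μ] (hsm : ∀ i, MeasurableSet (s i))
    (hs : iIndepSet s μ) {α : Type*} (F : α → Set ι) (E : α → Set Ω)
    (hE : ∀ a, MeasurableSet[eventSigma s (F a)] (E a)) (A : Finset α)
    (hF : ∀ a ∈ A, ∀ b ∈ A, a ≠ b → Disjoint (F a) (F b)) :
    μ.real (⋂ a ∈ A, E a) = ∏ a ∈ A, μ.real (E a) := by
  classical
  induction A using Finset.induction_on with
  | empty => simp
  | insert a A ha ih =>
    rw [Finset.prod_insert ha, Finset.set_biInter_insert,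
      measureReal_inter_of_disjoint hsm hs (S := F a) (T := ⋃ b ∈ A, F b) _ (hE a), ih]
    · exact fun b hb c hc => hF b (Finset.mem_insert_of_mem hb) c (Finset.mem_insert_of_mem hc)
    · refine Finset.measurableSet_biInter A fun b hb => ?_
      exact eventSigma_mono (Set.subset_biUnion_of_mem (u := F) (by exact hb)) _ (hE b)
    · rw [Set.disjoint_iUnion₂_right]
      exact fun b hb => hF a (Finset.mem_insert_self _ _) b (Finset.mem_insert_of_mem hb)
        (fun h => ha (h ▸ hb))

/-- Two siblings have disjoint subtrees. The index 0 must be excluded, being its own child and an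
ancestor of every node. -/
lemma heap_descendants_disjoint {x y k l : ℕ} (hx : 1 ≤ x) (hk : y / 2 ^ k = 2 * x)
    (hl : y / 2 ^ l = 2 * x + 1) : False := by
  rcases lt_trichotomy k l with h | rfl | h
  · obtain ⟨d, rfl⟩ := Nat.exists_eq_add_of_lt h
    rw [show k + d + 1 = k + (d + 1) by ring, pow_add, ← Nat.div_div_eq_div_mul, hk] at hl
    have := Nat.div_le_self (2 * x) (2 ^ (d + 1))
    omega
  · omega
  · obtain ⟨d, rfl⟩ := Nat.exists_eq_add_of_lt h
    rw [show l + d + 1 = l + 1 + d by ring, pow_add, pow_add, ← Nat.div_div_eq_div_mul,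
      ← Nat.div_div_eq_div_mul, hl] at hk
    have := Nat.div_le_self ((2 * x + 1) / 2 ^ 1) (2 ^ d)
    omega

/-- If every link is present with probability close to one, then the binary tree survives for `n`
generations with probability close to one. -/
lemma measureReal_survives [IsProbabilityMeasure μ] (hsm : ∀ i, MeasurableSet (s i))
    (hs : iIndepSet s μ) {F : ℕ → Set ι} {link : ℕ → Set Ω}
    (hF : ∀ x y, x ≠ y → Disjoint (F x) (F y))
    (hl : ∀ x, MeasurableSet[eventSigma s (F x)] (link x)) {e : ℝ} (he0 : 0 ≤ e) (he : e ≤ 1 / 4)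
    {N : ℕ} (hp : ∀ x, 2 ≤ x → x < N → 1 - e ≤ μ.real (link x)) (n x : ℕ) (hx : 1 ≤ x)
    (hN : (x + 1) * 2 ^ n ≤ N) : 1 - e ≤ μ.real (survives link n x) := by
  induction n generalizing x with
  | zero => simp [survives, he0]
  | succ n ih =>
    have hm := eventSigma_le hsm (s := s)
    have hmeas : ∀ z, MeasurableSet (link z ∩ survives link n z) := fun z =>
      ((hm _ _ (hl z))).inter (hm _ _ (measurableSet_survives hl n z))
    have key : ∀ z, z / 2 = x → (1 - e) * (1 - e) ≤ μ.real (link z ∩ survives link n z) := by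
      intro z hz
      have hz2 : 2 ≤ z := by omega
      have hzN : (z + 1) * 2 ^ n ≤ N := by
        refine le_trans ?_ hN
        rw [pow_succ']
        nlinarith [Nat.two_pow_pos n, show z + 1 ≤ (x + 1) * 2 by omega]
      have hzN' : z < N := by
        have : 1 ≤ 2 ^ n := Nat.one_le_two_pow
        nlinarith
      rw [measureReal_inter_of_disjoint hsm hs (S := F z) _ (hl z) (measurableSet_survives hl n z)]
      · exact mul_le_mul (hp z hz2 hzN') (ih z (by omega) hzN) (by linarith) measureReal_nonneg
      · rw [Set.disjoint_iUnion₂_right]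
        rintro y ⟨k, hk, hy⟩
        refine hF z y fun hzy => ?_
        subst hzy
        have : z / 2 ^ k < z := Nat.div_lt_self (by omega) (Nat.one_lt_two_pow (by omega))
        omega
    have hind : μ.real ((link (2 * x) ∩ survives link n (2 * x))ᶜ ∩
        (link (2 * x + 1) ∩ survives link n (2 * x + 1))ᶜ) =
        μ.real (link (2 * x) ∩ survives link n (2 * x))ᶜ *
        μ.real (link (2 * x + 1) ∩ survives link n (2 * x + 1))ᶜ := by
      have hσ : ∀ z, MeasurableSet[eventSigma s (⋃ y ∈ {y | ∃ k, y / 2 ^ k = z}, F y)]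
          (link z ∩ survives link n z) := by
        intro z
        refine MeasurableSet.inter ?_ ?_
        · refine eventSigma_mono ?_ _ (hl z)
          exact Set.subset_biUnion_of_mem (u := F) (show z ∈ {y | ∃ k, y / 2 ^ k = z} from
            ⟨0, by simp⟩)
        · refine eventSigma_mono ?_ _ (measurableSet_survives hl n z)
          exact Set.biUnion_subset_biUnion_left fun y ⟨k, _, hy⟩ => ⟨k, hy⟩
      refine measureReal_inter_of_disjoint hsm hs ?_ (hσ _).compl (hσ _).compl
      rw [Set.disjoint_iUnion₂_left]
      rintro y ⟨k, hy⟩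
      rw [Set.disjoint_iUnion₂_right]
      rintro z ⟨l, hz⟩
      refine hF y z fun hyz => ?_
      subst hyz
      exact heap_descendants_disjoint hx hy hz
    have h1 := key (2 * x) (by omega)
    have h2 := key (2 * x + 1) (by omega)
    have h3 : μ.real (survives link (n + 1) x) =
        1 - (1 - μ.real (link (2 * x) ∩ survives link n (2 * x))) *
          (1 - μ.real (link (2 * x + 1) ∩ survives link n (2 * x + 1))) := by
      rw [← probReal_compl_eq_one_sub (hmeas _), ← probReal_compl_eq_one_sub (hmeas _), ← hind,
        ← Set.compl_union, probReal_compl_eq_one_sub ((hmeas _).union (hmeas _)), survives]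
      ring
    rw [h3]
    have h4 : ∀ z, μ.real (link z ∩ survives link n z) ≤ 1 := fun z => measureReal_le_one
    -- The route through one child fails with probability at most 1 - (1-e)² ≤ 2e, and the two
    -- routes fail independently. The bound 4e² ≤ e, which closes the induction, is where e ≤ 1/4
    -- enters.
    have h5 : (1 - μ.real (link (2 * x) ∩ survives link n (2 * x))) *
          (1 - μ.real (link (2 * x + 1) ∩ survives link n (2 * x + 1))) ≤ (2 * e) * (2 * e) :=
      mul_le_mul (by nlinarith) (by nlinarith) (by linarith [h4 (2 * x + 1)]) (by linarith)
    nlinarith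
end Independence

/-! ### Expanding permutations by a counting argument. -/

section PermutationExpander

lemma two_pow_le_choose {m s : ℕ} (h : 2 * s ≤ m) : 2 ^ s ≤ m.choose s := by
  refine le_trans ?_ (Nat.choose_le_choose s h)
  rw [← Nat.centralBinom_eq_two_mul_choose]
  induction s with
  | zero => simp
  | succ n ih =>
    have := Nat.succ_mul_centralBinom_succ n
    have h2 := ih (by omega)
    rw [pow_succ]
    nlinarith

lemma choose_le_choose_of_two_mul_le {m r s : ℕ} (hrs : r ≤ s) (hs : 2 * s ≤ m) :
    m.choose r ≤ m.choose s := by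
  induction s, hrs using Nat.le_induction with
  | base => exact le_rfl
  | succ s hrs ih =>
    exact (ih (by omega)).trans (Nat.choose_le_succ_of_lt_half_left (by omega))

/-- A single term of the expansion of (8+1)^(s+r) is at most the sum. After taking 20th powers the
claim becomes 9^22 ≤ 2^10 · 8^20 = 2^70. -/
lemma choose_add_div_ten_sq_le (s : ℕ) : ((s + s / 10).choose s) ^ 2 ≤ 2 ^ s := by
  set r := s / 10 with hr
  have h1 : (s + r).choose s * 8 ^ s ≤ 9 ^ (s + r) := by
    have h := add_pow (8 : ℕ) 1 (s + r)
    norm_num at h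
    rw [h]
    refine le_trans (le_of_eq (mul_comm _ _))
      (Finset.single_le_sum (f := fun x => 8 ^ x * (s + r).choose x) (fun _ _ => Nat.zero_le _)
        (Finset.mem_range.2 (show s < s + r + 1 by omega)))
  have h2 : ((s + r).choose s ^ 2) ^ 10 * (8 ^ 20) ^ s ≤ (2 ^ s) ^ 10 * (8 ^ 20) ^ s := by
    calc ((s + r).choose s ^ 2) ^ 10 * (8 ^ 20) ^ s = ((s + r).choose s * 8 ^ s) ^ 20 := by
          rw [mul_pow, ← pow_mul, ← pow_mul, ← pow_mul]; ring_nf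
      _ ≤ (9 ^ (s + r)) ^ 20 := Nat.pow_le_pow_left h1 20
      _ = 9 ^ (20 * s + 20 * r) := by rw [← pow_mul]; ring_nf
      _ ≤ 9 ^ (22 * s) := Nat.pow_le_pow_right (by norm_num) (by omega)
      _ = (9 ^ 22) ^ s := by rw [pow_mul]
      _ ≤ (2 ^ 10 * 8 ^ 20) ^ s := Nat.pow_le_pow_left (by norm_num) s
      _ = (2 ^ s) ^ 10 * (8 ^ 20) ^ s := by rw [mul_pow, ← pow_mul, ← pow_mul]; ring_nf
  have h3 := Nat.le_of_mul_le_mul_right h2 (by positivity)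
  exact (Nat.pow_le_pow_iff_left (by norm_num)).1 h3

variable {Y : Type*} [Fintype Y] [DecidableEq Y]

/-- The number of permutations taking `S` onto a given set of the same size. -/
lemma card_perm_map_eq (S U : Finset Y) (h : U.card = S.card) :
    (Finset.univ.filter fun π : Equiv.Perm Y => S.map π.toEmbedding = U).card *
      (Fintype.card Y).choose S.card = (Fintype.card Y).factorial := by
  -- The symmetric group is transitive on sets of a given size, so every possible image of `S` is
  -- attained equally often.
  have hconst : ∀ U' ∈ Finset.powersetCard S.card (Finset.univ : Finset Y),
      (Finset.univ.filter fun π : Equiv.Perm Y => S.map π.toEmbedding = U').card =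
      (Finset.univ.filter fun π : Equiv.Perm Y => S.map π.toEmbedding = U).card := by
    intro U' hU'
    rw [Finset.mem_powersetCard_univ] at hU'
    obtain ⟨g, hg⟩ : ∃ g : Equiv.Perm Y, U'.map g.toEmbedding = U := by
      have e : {x // x ∈ U'} ≃ {x // x ∈ U} := Finset.equivOfCardEq (by omega)
      refine ⟨e.extendSubtype, ?_⟩
      refine Finset.eq_of_subset_of_card_le ?_ (by simp [h, hU'])
      intro y hy
      rw [Finset.mem_map] at hy
      obtain ⟨x, hx, rfl⟩ := hy
      exact e.extendSubtype_mem x hx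
    refine Finset.card_bij' (fun π _ => π.trans g) (fun π _ => π.trans g.symm) ?_ ?_ ?_ ?_
    · intro π hπ
      simp only [Finset.mem_filter, Finset.mem_univ, true_and] at hπ ⊢
      rw [← hg, ← hπ, Finset.map_map]
      rfl
    · intro π hπ
      simp only [Finset.mem_filter, Finset.mem_univ, true_and] at hπ ⊢
      have : U' = U.map g.symm.toEmbedding := by
        rw [← hg, Finset.map_map]; ext x; simp
      rw [this, ← hπ, Finset.map_map]
      rfl
    · intro π _; ext; simp
    · intro π _; ext; simp
  have hsum := Finset.card_eq_sum_card_fiberwise (s := (Finset.univ : Finset (Equiv.Perm Y)))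
    (t := Finset.powersetCard S.card Finset.univ) (f := fun π => S.map π.toEmbedding)
    (fun π _ => by simp)
  rw [Finset.sum_congr rfl hconst, Finset.sum_const, Finset.card_powersetCard, Finset.card_univ,
    Finset.card_univ, Fintype.card_perm, smul_eq_mul] at hsum
  rw [hsum, mul_comm]

lemma card_perm_map_subset_mul (S T : Finset Y) :
    (Finset.univ.filter fun π : Equiv.Perm Y => S.map π.toEmbedding ⊆ T).card *
      (Fintype.card Y).choose S.card = T.card.choose S.card * (Fintype.card Y).factorial := by
  have hsum := Finset.card_eq_sum_card_fiberwise
    (s := Finset.univ.filter fun π : Equiv.Perm Y => S.map π.toEmbedding ⊆ T)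
    (t := Finset.powersetCard S.card T) (f := fun π => S.map π.toEmbedding)
    (fun π hπ => by simpa using hπ)
  rw [hsum, Finset.sum_mul, ← Finset.card_powersetCard, ← smul_eq_mul, ← Finset.sum_const]
  refine Finset.sum_congr rfl fun U hU => ?_
  rw [Finset.mem_powersetCard] at hU
  rw [← card_perm_map_eq S U hU.2, Finset.filter_filter]
  congr 2
  ext π
  simp only [Finset.mem_filter, Finset.mem_univ, true_and]
  exact ⟨fun h => h.2, fun h => ⟨h ▸ hU.1, h⟩⟩

/-- Few octuples of permutations map `S` into a given slightly larger set `T`. -/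
lemma card_perms_map_subset_le {S T : Finset Y} (hS : 2 * S.card ≤ Fintype.card Y)
    (hT : T.card = S.card + S.card / 10) :
    (Finset.univ.filter fun π : Fin 8 → Equiv.Perm Y =>
        ∀ i, S.map (π i).toEmbedding ⊆ T).card * (Fintype.card Y).choose S.card ^ 4 ≤
      (Fintype.card Y).factorial ^ 8 := by
  have h1 : (Finset.univ.filter fun π : Fin 8 → Equiv.Perm Y =>
      ∀ i, S.map (π i).toEmbedding ⊆ T) =
      Fintype.piFinset fun _ => Finset.univ.filter fun π : Equiv.Perm Y =>
        S.map π.toEmbedding ⊆ T := by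
    ext π; simp
  rw [h1, Fintype.card_piFinset, Finset.prod_const, Finset.card_univ, Fintype.card_fin]
  set a := (Finset.univ.filter fun π : Equiv.Perm Y => S.map π.toEmbedding ⊆ T).card
  set c := (Fintype.card Y).choose S.card with hc
  set f := (Fintype.card Y).factorial
  have h2 : a * c = T.card.choose S.card * f := card_perm_map_subset_mul S T
  -- One permutation maps S into T for a proportion C(|T|,|S|)/c ≤ c^(-1/2) of all permutations;
  -- eight independent ones give c^(-4).
  have h3 : T.card.choose S.card ^ 2 ≤ c := by
    rw [hT]
    exact (choose_add_div_ten_sq_le _).trans (two_pow_le_choose hS)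
  have hc0 : 0 < c := lt_of_lt_of_le (by positivity) (two_pow_le_choose hS)
  refine Nat.le_of_mul_le_mul_right (c := c ^ 4) ?_ (by positivity)
  calc a ^ 8 * c ^ 4 * c ^ 4 = (a * c) ^ 8 := by ring
    _ = (T.card.choose S.card ^ 2) ^ 4 * f ^ 8 := by rw [h2]; ring
    _ ≤ c ^ 4 * f ^ 8 := Nat.mul_le_mul_right _ (Nat.pow_le_pow_left h3 4)
    _ = f ^ 8 * c ^ 4 := mul_comm _ _

/-- There are eight permutations that expand every set of at most half of the points. -/
theorem exists_expanding_perms (Y : Type*) [Fintype Y] [DecidableEq Y] :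
    ∃ π : Fin 8 → Equiv.Perm Y, ∀ S : Finset Y, 2 * S.card ≤ Fintype.card Y →
      S.card ≤ 10 * ((Finset.univ.biUnion fun i => S.map (π i).toEmbedding) \ S).card := by
  by_contra hcon
  push Not at hcon
  set m := Fintype.card Y with hm
  -- If every octuple fails, each has a set S whose images add fewer than |S|/10 new points; these
  -- are padded to a set R of exactly ⌊|S|/10⌋ points outside S.
  have hcover : (Finset.univ : Finset (Fin 8 → Equiv.Perm Y)) ⊆
      (Finset.Icc 1 (m / 2)).biUnion fun s =>
        ((Finset.powersetCard s Finset.univ) ×ˢ (Finset.powersetCard (s / 10) Finset.univ)).biUnion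
          fun ST => if Disjoint ST.1 ST.2 then Finset.univ.filter fun π : Fin 8 → Equiv.Perm Y =>
            ∀ i, ST.1.map (π i).toEmbedding ⊆ ST.1 ∪ ST.2 else ∅ := by
    intro π _
    obtain ⟨S, hS, hlt⟩ := hcon π
    obtain ⟨R, hR1, hR2, hR3⟩ := Finset.exists_subsuperset_card_eq
      (s := (Finset.univ.biUnion fun i => S.map (π i).toEmbedding) \ S) (t := Sᶜ) (n := S.card / 10)
      (fun x hx => by simpa using (Finset.mem_sdiff.1 hx).2) (by omega)
      (by rw [Finset.card_compl]; omega)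
    simp only [Finset.mem_biUnion, Finset.mem_Icc, Finset.mem_product,
      Finset.mem_powersetCard_univ]
    have hd : Disjoint S R := Finset.disjoint_left.2 fun x hx hxR => by
      simpa [hx] using hR2 hxR
    refine ⟨S.card, ⟨by omega, by omega⟩, (S, R), ⟨rfl, hR3⟩, ?_⟩
    rw [if_pos hd]
    simp only [Finset.mem_filter, Finset.mem_univ, true_and]
    intro i x hx
    by_cases hxS : x ∈ S
    · exact Finset.mem_union_left _ hxS
    · exact Finset.mem_union_right _ (hR1 (Finset.mem_sdiff.2
        ⟨Finset.mem_biUnion.2 ⟨i, Finset.mem_univ _, hx⟩, hxS⟩))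
  have hcard := (Finset.card_le_card hcover).trans Finset.card_biUnion_le
  -- There are at most c² pairs (S, R), each accounting for at most a fraction c^(-4) of the
  -- octuples, and c ≥ 2^s. The fractions 4^(-s) sum to less than 1/3, so the failing octuples
  -- cannot be all.
  have hterm : ∀ s ∈ Finset.Icc 1 (m / 2),
      (((((Finset.powersetCard s Finset.univ) ×ˢ
        (Finset.powersetCard (s / 10) Finset.univ)).biUnion
          fun ST : Finset Y × Finset Y => if Disjoint ST.1 ST.2 then
            Finset.univ.filter fun π : Fin 8 → Equiv.Perm Y =>
            ∀ i, ST.1.map (π i).toEmbedding ⊆ ST.1 ∪ ST.2 else ∅).card : ℕ) : ℝ) ≤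
        (m.factorial : ℝ) ^ 8 * (1 / 4) ^ s := by
    intro s hs
    rw [Finset.mem_Icc] at hs
    have h2s : 2 * s ≤ m := by omega
    set c := m.choose s with hc
    have hc2 : 2 ^ s ≤ c := two_pow_le_choose h2s
    have hc0 : (0 : ℝ) < c := by
      exact_mod_cast lt_of_lt_of_le (by positivity) hc2
    have hb : ∀ ST ∈ (Finset.powersetCard s Finset.univ) ×ˢ
        (Finset.powersetCard (s / 10) (Finset.univ : Finset Y)),
        (((if Disjoint ST.1 ST.2 then Finset.univ.filter fun π : Fin 8 → Equiv.Perm Y =>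
            ∀ i, ST.1.map (π i).toEmbedding ⊆ ST.1 ∪ ST.2 else ∅ : Finset _).card : ℕ) : ℝ) ≤
          (m.factorial : ℝ) ^ 8 / (c : ℝ) ^ 4 := by
      rintro ⟨S, R⟩ hSR
      rw [Finset.mem_product, Finset.mem_powersetCard_univ, Finset.mem_powersetCard_univ] at hSR
      obtain ⟨rfl, hR⟩ := hSR
      dsimp only at hR hc ⊢
      split_ifs with hd
      · rw [le_div_iff₀ (by positivity)]
        exact_mod_cast card_perms_map_subset_le (S := S) (T := S ∪ R) h2s
          (by rw [Finset.card_union_of_disjoint hd, hR])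
      · simp only [Finset.card_empty, Nat.cast_zero]; positivity
    calc _ ≤ ∑ ST ∈ (Finset.powersetCard s Finset.univ) ×ˢ
          (Finset.powersetCard (s / 10) (Finset.univ : Finset Y)),
          (m.factorial : ℝ) ^ 8 / (c : ℝ) ^ 4 := by
          refine le_trans ?_ (Finset.sum_le_sum hb)
          exact_mod_cast Finset.card_biUnion_le
      _ = (c : ℝ) * (m.choose (s / 10) : ℝ) * ((m.factorial : ℝ) ^ 8 / (c : ℝ) ^ 4) := by
          rw [Finset.sum_const, Finset.card_product, Finset.card_powersetCard,
            Finset.card_powersetCard, Finset.card_univ, nsmul_eq_mul]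
          push_cast
          rfl
      _ ≤ (c : ℝ) * c * ((m.factorial : ℝ) ^ 8 / (c : ℝ) ^ 4) := by
          gcongr
          exact choose_le_choose_of_two_mul_le (by omega) h2s
      _ = (m.factorial : ℝ) ^ 8 * (1 / (c : ℝ) ^ 2) := by
          field_simp
      _ ≤ (m.factorial : ℝ) ^ 8 * (1 / 4) ^ s := by
          gcongr
          rw [one_div_pow]
          have : (4 : ℝ) ^ s ≤ (c : ℝ) ^ 2 := by
            have h4 : (4 : ℕ) ^ s ≤ c ^ 2 := by
              calc (4 : ℕ) ^ s = (2 ^ s) ^ 2 := by rw [← pow_mul, mul_comm, pow_mul]; norm_num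
                _ ≤ c ^ 2 := Nat.pow_le_pow_left hc2 2
            exact_mod_cast h4
          exact one_div_le_one_div_of_le (by positivity) this
  have hcard' : ((m.factorial : ℝ) ^ 8) ≤
      ∑ s ∈ Finset.Icc 1 (m / 2), (m.factorial : ℝ) ^ 8 * (1 / 4) ^ s := by
    refine le_trans ?_ (Finset.sum_le_sum hterm)
    have h8 : (Finset.univ : Finset (Fin 8 → Equiv.Perm Y)).card = m.factorial ^ 8 := by
      simp [Fintype.card_perm, hm]
    rw [h8] at hcard
    exact_mod_cast hcard
  have hgeom : ∀ k : ℕ, ∑ s ∈ Finset.Icc 1 k, ((1 : ℝ) / 4) ^ s ≤ 1 / 3 - 1 / 3 * (1 / 4) ^ k := by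
    intro k
    induction k with
    | zero => simp
    | succ k ih =>
      rw [Finset.sum_Icc_succ_top (by omega), pow_succ]
      linarith
  rw [← Finset.mul_sum] at hcard'
  have hpos : (0 : ℝ) < (m.factorial : ℝ) ^ 8 := by positivity
  have h4 : (0 : ℝ) < (1 / 4 : ℝ) ^ (m / 2) := by positivity
  nlinarith [hgeom (m / 2)]

end PermutationExpander

/-! ### Bundles of subdivided stars. -/

section SpiderBundle

/-- A star with one leg of `K + 1` vertices for each element of `S`; the centre is `none`. -/
abbrev Spider (S : Type*) (K : ℕ) := Option (S × Fin (K + 1))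

variable {Y S : Type*} {K : ℕ}

/-- The vertex at distance `j` from the centre on the leg `σ`. -/
def leg (σ : S) : ℕ → Spider S K
  | 0 => none
  | j + 1 => some (σ, Fin.ofNat (K + 1) j)

@[simp] lemma leg_zero (σ : S) : (leg σ 0 : Spider S K) = none := rfl

lemma leg_succ_ne_none (σ : S) (j : ℕ) : (leg σ (j + 1) : Spider S K) ≠ none :=
  Option.some_ne_none _

lemma leg_inj {σ τ : S} {i j : ℕ} (hi0 : 1 ≤ i) (hi : i ≤ K + 1) (hj : j ≤ K + 1)
    (h : (leg σ i : Spider S K) = leg τ j) : σ = τ ∧ i = j := by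
  obtain ⟨i, rfl⟩ := Nat.exists_eq_add_of_le' hi0
  cases j with
  | zero => exact absurd h (leg_succ_ne_none _ _)
  | succ j =>
    simp only [leg, Option.some.injEq, Prod.mk.injEq, Fin.ext_iff, Fin.val_ofNat] at h
    rw [Nat.mod_eq_of_lt (by omega), Nat.mod_eq_of_lt (by omega)] at h
    exact ⟨h.1, by omega⟩

lemma exists_eq_leg [Nonempty S] (b : Spider S K) : ∃ σ j, j ≤ K + 1 ∧ b = leg σ j := by
  rcases b with _ | ⟨σ, j⟩
  · exact ⟨Classical.arbitrary S, 0, by omega, rfl⟩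
  · refine ⟨σ, j + 1, by omega, ?_⟩
    simp [leg]

/-- A spider over every point of `Y`, the tip of leg `σ` over `y` being joined to `exit y σ`. -/
def spiderBundle (exit : Y → S → Y × Spider S K) : SimpleGraph (Y × Spider S K) :=
  SimpleGraph.fromRel fun u v =>
    (∃ σ j, j ≤ K ∧ u.2 = leg σ j ∧ v = (u.1, leg σ (j + 1))) ∨
      ∃ σ, u.2 = leg σ (K + 1) ∧ v = exit u.1 σ

variable (exit : Y → S → Y × Spider S K)

lemma spiderBundle_adj_leg (y : Y) (σ : S) {j : ℕ} (hj : j ≤ K) :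
    (spiderBundle exit).Adj (y, leg σ j) (y, leg σ (j + 1)) := by
  refine (SimpleGraph.fromRel_adj _ _ _).2 ⟨fun h => ?_, Or.inl (Or.inl ⟨σ, j, hj, rfl, rfl⟩)⟩
  have h1 : (leg σ (j + 1) : Spider S K) = leg σ j := (Prod.ext_iff.1 h).2.symm
  have := leg_inj (by omega) (by omega) (by omega) h1
  omega

lemma spiderBundle_adj_exit (y : Y) (σ : S) (h : (y, leg σ (K + 1)) ≠ exit y σ) :
    (spiderBundle exit).Adj (y, leg σ (K + 1)) (exit y σ) :=
  (SimpleGraph.fromRel_adj _ _ _).2 ⟨h, Or.inl (Or.inr ⟨σ, rfl, rfl⟩)⟩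

lemma edist_centre_leg_le (y : Y) (σ : S) {j : ℕ} (hj : j ≤ K + 1) :
    (spiderBundle exit).edist (y, none) (y, leg σ j) ≤ j := by
  induction j with
  | zero => simp
  | succ j ih =>
    refine (SimpleGraph.edist_triangle (v := (y, leg σ j))).trans ?_
    push_cast
    exact add_le_add (ih (by omega))
      (SimpleGraph.edist_eq_one_iff_adj.2 (spiderBundle_adj_leg exit y σ (by omega))).le

lemma edist_centre_le [Nonempty S] (y : Y) (b : Spider S K) :
    (spiderBundle exit).edist (y, none) (y, b) ≤ (K + 1 : ℕ) := by
  obtain ⟨σ, j, hj, rfl⟩ := exists_eq_leg b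
  exact (edist_centre_leg_le exit y σ hj).trans (by exact_mod_cast hj)

end SpiderBundle

/-! ### Words in the permutations and growth of word balls. -/

section Letters
variable {Y : Type*}

/-- The letters encoding eight permutations, their inverses and the identity. -/
abbrev Letter := Option (Fin 8 × Bool)

/-- The letter encoding the inverse permutation. -/
def Letter.opp : Letter → Letter := Option.map fun x => (x.1, !x.2)

/-- The permutation encoded by a letter. -/
def letterPerm (π : Fin 8 → Equiv.Perm Y) : Letter → Equiv.Perm Y
  | none => 1
  | some (i, true) => π i
  | some (i, false) => (π i)⁻¹

variable (π : Fin 8 → Equiv.Perm Y)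

lemma letterPerm_opp_apply (σ : Letter) (y : Y) :
    letterPerm π σ.opp (letterPerm π σ y) = y := by
  rcases σ with _ | ⟨i, _ | _⟩ <;> simp [Letter.opp, letterPerm]

/-- The points reached from `y` by words of length `r`. -/
def wordBall [DecidableEq Y] (y : Y) : ℕ → Finset Y
  | 0 => {y}
  | r + 1 => (wordBall y r).biUnion fun z => Finset.univ.image fun σ : Letter => letterPerm π σ z

variable [DecidableEq Y]

lemma mem_wordBall_succ {y z : Y} {r : ℕ} (h : z ∈ wordBall π y r) (σ : Letter) :
    letterPerm π σ z ∈ wordBall π y (r + 1) :=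
  Finset.mem_biUnion.2 ⟨z, h, Finset.mem_image_of_mem _ (Finset.mem_univ σ)⟩

lemma wordBall_mono (y : Y) : Monotone (wordBall π y) :=
  monotone_nat_of_le_succ fun _ _ hz => mem_wordBall_succ π hz none

lemma card_wordBall_le (y : Y) (r : ℕ) : (wordBall π y r).card ≤ 17 ^ r := by
  induction r with
  | zero => simp [wordBall]
  | succ r ih =>
    refine (Finset.card_biUnion_le_card_mul _ _ 17 fun z _ => ?_).trans ?_
    · refine Finset.card_image_le.trans ?_
      simp [Finset.card_univ]
    · rw [pow_succ]
      exact Nat.mul_le_mul_right _ ih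

/-- The permutations `π` move every set of at most half of the points by a definite proportion. -/
def Expanding [Fintype Y] (π : Fin 8 → Equiv.Perm Y) : Prop :=
  ∀ S : Finset Y, 2 * S.card ≤ Fintype.card Y →
    S.card ≤ 10 * ((Finset.univ.biUnion fun i => S.map (π i).toEmbedding) \ S).card

variable {π}

/-- As long as the ball holds at most half of the points, one more letter multiplies its size by at
least 11/10. -/
lemma lt_two_mul_card_wordBall [Fintype Y] (hπ : Expanding π) (y : Y) {r : ℕ}
    (hr : 10 ^ r * Fintype.card Y < 11 ^ r) : Fintype.card Y < 2 * (wordBall π y r).card := by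
  have key : ∀ r, Fintype.card Y < 2 * (wordBall π y r).card ∨
      11 ^ r ≤ 10 ^ r * (wordBall π y r).card := by
    intro r
    induction r with
    | zero => right; simp [wordBall]
    | succ r ih =>
      have hsub : (wordBall π y r).card ≤ (wordBall π y (r + 1)).card :=
        Finset.card_le_card (wordBall_mono π y (Nat.le_succ r))
      rcases ih with h | h
      · left; omega
      · by_cases h2 : Fintype.card Y < 2 * (wordBall π y r).card
        · left; omega
        right
        have hexp := hπ (wordBall π y r) (by omega)
        set N := (Finset.univ.biUnion fun i => (wordBall π y r).map (π i).toEmbedding) with hN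
        have h3 : wordBall π y r ∪ (N \ wordBall π y r) ⊆ wordBall π y (r + 1) := by
          refine Finset.union_subset (wordBall_mono π y (Nat.le_succ r)) fun z hz => ?_
          obtain ⟨i, -, hi⟩ := Finset.mem_biUnion.1 (Finset.mem_sdiff.1 hz).1
          obtain ⟨x, hx, rfl⟩ := Finset.mem_map.1 hi
          exact mem_wordBall_succ π hx (some (i, true))
        have h4 := Finset.card_le_card h3
        rw [Finset.card_union_of_disjoint Finset.disjoint_sdiff] at h4
        rw [pow_succ, pow_succ]
        have h5 : 11 * (wordBall π y r).card ≤ 10 * (wordBall π y (r + 1)).card := by omega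
        calc 11 ^ r * 11 ≤ 10 ^ r * (wordBall π y r).card * 11 := Nat.mul_le_mul_right _ h
          _ = 10 ^ r * (11 * (wordBall π y r).card) := by ring
          _ ≤ 10 ^ r * (10 * (wordBall π y (r + 1)).card) := Nat.mul_le_mul_left _ h5
          _ = _ := by ring
  rcases key r with h | h
  · exact h
  · have h6 := lt_of_lt_of_le hr h
    have h7 := lt_of_mul_lt_mul_left h6 (Nat.zero_le _)
    omega

end Letters

/-! ### The subdivided expander: diameter and edge expansion. -/

section Host
variable {Y : Type*} (π : Fin 8 → Equiv.Perm Y) (K : ℕ)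

/-- The expander over `Y` with edges `y — π i y`, every edge being subdivided many times. -/
def hostGraph : SimpleGraph (Y × Spider Letter K) :=
  spiderBundle fun y σ => (letterPerm π σ y, leg σ.opp (K + 1))

variable {π K}

lemma hostGraph_edist_step_le (y : Y) (σ : Letter) :
    (hostGraph π K).edist (y, none) (letterPerm π σ y, none) ≤ (2 * K + 3 : ℕ) := by
  have h1 : (hostGraph π K).edist (y, leg σ (K + 1)) (letterPerm π σ y, leg σ.opp (K + 1)) ≤
      (1 : ℕ) := by
    by_cases h : (y, (leg σ (K + 1) : Spider Letter K)) = (letterPerm π σ y, leg σ.opp (K + 1))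
    · rw [← h]; simp
    · exact (SimpleGraph.edist_eq_one_iff_adj.2 (spiderBundle_adj_exit _ y σ h)).le
  have h2 := edist_centre_le (fun y σ => (letterPerm π σ y, leg σ.opp (K + 1))) y
    (leg σ (K + 1) : Spider Letter K)
  have h3 := edist_centre_le (fun y σ => (letterPerm π σ y, leg σ.opp (K + 1)))
    (letterPerm π σ y) (leg σ.opp (K + 1) : Spider Letter K)
  rw [SimpleGraph.edist_comm] at h3
  refine (SimpleGraph.edist_triangle.trans (add_le_add h2
    (SimpleGraph.edist_triangle.trans (add_le_add h1 h3)))).trans ?_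
  norm_cast
  omega

lemma hostGraph_edist_wordBall_le [DecidableEq Y] {y z : Y} {r : ℕ} (h : z ∈ wordBall π y r) :
    (hostGraph π K).edist (y, none) (z, none) ≤ (r * (2 * K + 3) : ℕ) := by
  induction r generalizing z with
  | zero =>
    rw [wordBall, Finset.mem_singleton] at h
    simp [h]
  | succ r ih =>
    obtain ⟨x, hx, hz⟩ := Finset.mem_biUnion.1 h
    obtain ⟨σ, -, rfl⟩ := Finset.mem_image.1 hz
    have h1 := (SimpleGraph.edist_triangle (G := hostGraph π K) (u := (y, none))
      (v := (x, none)) (w := (letterPerm π σ x, none))).trans (add_le_add (ih hx)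
      (hostGraph_edist_step_le x σ))
    rwa [← Nat.cast_add, ← Nat.succ_mul] at h1

/-- Two balls that each hold more than half of the points intersect, so any two centres are within
2r subdivided edges; reaching the centres costs at most K+1 at each end. -/
lemma hostGraph_ediam_le [DecidableEq Y] [Fintype Y] (hπ : Expanding π) {r : ℕ}
    (hr : 10 ^ r * Fintype.card Y < 11 ^ r) :
    (hostGraph π K).ediam ≤ (2 * (r + 1) * (2 * K + 3) : ℕ) := by
  refine SimpleGraph.ediam_le_of_edist_le ?_
  rintro ⟨y, b⟩ ⟨z, c⟩
  obtain ⟨x, hx⟩ : (wordBall π y r ∩ wordBall π z r).Nonempty := by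
    rw [Finset.nonempty_iff_ne_empty]
    intro h
    have h1 := Finset.card_union_of_disjoint (Finset.disjoint_iff_inter_eq_empty.2 h)
    have h2 := Finset.card_le_univ (wordBall π y r ∪ wordBall π z r)
    have h3 := lt_two_mul_card_wordBall hπ y hr
    have h4 := lt_two_mul_card_wordBall hπ z hr
    omega
  rw [Finset.mem_inter] at hx
  have h1 := edist_centre_le (fun y σ => (letterPerm π σ y, leg σ.opp (K + 1))) y b
  have h2 := edist_centre_le (fun y σ => (letterPerm π σ y, leg σ.opp (K + 1))) z c
  have h3 := hostGraph_edist_wordBall_le (K := K) hx.1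
  have h4 := hostGraph_edist_wordBall_le (K := K) hx.2
  rw [SimpleGraph.edist_comm] at h1 h4
  refine (SimpleGraph.edist_triangle.trans (add_le_add h1 (SimpleGraph.edist_triangle.trans
    (add_le_add h3 (SimpleGraph.edist_triangle.trans (add_le_add h4 h2)))))).trans ?_
  norm_cast
  nlinarith

/-- The edge expansion of the subdivided expander. -/
lemma hostGraph_expansion [DecidableEq Y] [Fintype Y] (hπ : Expanding π)
    (G : SimpleGraph (Y × Spider Letter K)) [DecidableRel G.Adj] (hG : hostGraph π K ≤ G)
    (S : Finset (Y × Spider Letter K)) (hS : 2 * S.card ≤ Fintype.card (Y × Spider Letter K)) :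
    S.card ≤ 11 * Fintype.card (Spider Letter K) * (G.interedges S Sᶜ).card := by
  classical
  set F := Finset.univ.filter fun y : Y => ∀ b, (y, b) ∈ S with hF
  set P := Finset.univ.filter fun y : Y => (∃ b, (y, b) ∈ S) ∧ ∃ b, (y, b) ∉ S with hP
  set N := (Finset.univ.biUnion fun i => F.map (π i).toEmbedding) with hN
  set β := Fintype.card (Spider Letter K) with hβ
  -- `F` and `P` are the points with full and with partial fibres. A partial fibre is connected,
  -- hence contains a cut edge; an empty fibre adjacent to a full one is entered by the cut edge
  -- joining their tips. Cut edges are indexed by the point below their endpoint outside `S`.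
  have hcut : P ∪ (N \ F) ⊆ (G.interedges S Sᶜ).image fun e => e.2.1 := by
    have hpair : ∀ u v, u ∈ S → v ∉ S → (hostGraph π K).Adj u v →
        v.1 ∈ (G.interedges S Sᶜ).image fun e => e.2.1 := fun u v hu hv huv =>
      Finset.mem_image.2 ⟨(u, v), (SimpleGraph.mem_interedges_iff G).2
        ⟨hu, Finset.mem_compl.2 hv, hG huv⟩, rfl⟩
    have hpart : P ⊆ (G.interedges S Sᶜ).image fun e => e.2.1 := by
      intro y hy
      by_contra hcon
      have hstep : ∀ σ : Letter, ∀ j ≤ K,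
          ((y, (leg σ j : Spider Letter K)) ∈ S ↔ (y, (leg σ (j + 1) : Spider Letter K)) ∈ S) := by
        intro σ j hj
        have hadj : (hostGraph π K).Adj _ _ := spiderBundle_adj_leg _ y σ hj
        by_contra hne
        by_cases h1 : (y, (leg σ j : Spider Letter K)) ∈ S
        · exact hcon (hpair _ _ h1 (fun h2 => hne ⟨fun _ => h2, fun _ => h1⟩) hadj)
        · by_cases h2 : (y, (leg σ (j + 1) : Spider Letter K)) ∈ S
          · exact hcon (hpair _ _ h2 h1 hadj.symm)
          · exact hne ⟨fun h => absurd h h1, fun h => absurd h h2⟩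
      have hall : ∀ σ : Letter, ∀ j ≤ K + 1,
          ((y, (none : Spider Letter K)) ∈ S ↔ (y, (leg σ j : Spider Letter K)) ∈ S) := by
        intro σ j
        induction j with
        | zero => intro _; rfl
        | succ j ih => intro hj; exact (ih (by omega)).trans (hstep σ j (by omega))
      obtain ⟨-, ⟨b, hb⟩, ⟨c, hc⟩⟩ := Finset.mem_filter.1 hy
      obtain ⟨σ, j, hj, rfl⟩ := exists_eq_leg b
      obtain ⟨τ, i, hi, rfl⟩ := exists_eq_leg c
      exact hc ((hall τ i hi).1 ((hall σ j hj).2 hb))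
    refine Finset.union_subset hpart fun z hz => ?_
    by_cases hzP : z ∈ P
    · exact hpart hzP
    rw [Finset.mem_sdiff] at hz
    obtain ⟨i, -, hi⟩ := Finset.mem_biUnion.1 hz.1
    obtain ⟨y, hy, rfl⟩ := Finset.mem_map.1 hi
    have hempty : ∀ b, (π i y, b) ∉ S := by
      intro b hb
      have h1 := hz.2
      simp only [hF, Finset.mem_filter, Finset.mem_univ, true_and, not_forall] at h1
      exact hzP (Finset.mem_filter.2 ⟨Finset.mem_univ _, ⟨b, hb⟩, h1⟩)
    have hfull := (Finset.mem_filter.1 hy).2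
    refine hpair (y, leg (some (i, true)) (K + 1)) (π i y, leg (some (i, false)) (K + 1))
      (hfull _) (hempty _) ?_
    refine spiderBundle_adj_exit (fun y σ => (letterPerm π σ y, leg σ.opp (K + 1))) y
      (some (i, true)) fun h => ?_
    have h1 := hfull (leg (some (i, true)) (K + 1))
    rw [h] at h1
    exact hempty _ h1
  have hcard := (Finset.card_le_card hcut).trans Finset.card_image_le
  have h1 : P.card ≤ (G.interedges S Sᶜ).card :=
    (Finset.card_le_card Finset.subset_union_left).trans hcard
  have h2 : (N \ F).card ≤ (G.interedges S Sᶜ).card :=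
    (Finset.card_le_card Finset.subset_union_right).trans hcard
  have hFS : F ×ˢ (Finset.univ : Finset (Spider Letter K)) ⊆ S := fun u hu =>
    (Finset.mem_filter.1 (Finset.mem_product.1 hu).1).2 u.2
  have hFc := Finset.card_le_card hFS
  rw [Finset.card_product, Finset.card_univ] at hFc
  rw [Fintype.card_prod] at hS
  have hβ0 : 0 < β := Fintype.card_pos
  have hF2 : 2 * F.card ≤ Fintype.card Y := by
    refine Nat.le_of_mul_le_mul_right (c := β) ?_ hβ0
    linarith
  have h3 : F.card ≤ 10 * (N \ F).card := hπ F hF2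
  have hSS : S ⊆ (F ∪ P) ×ˢ Finset.univ := by
    intro u hu
    refine Finset.mem_product.2 ⟨?_, Finset.mem_univ _⟩
    by_cases h : ∀ b, (u.1, b) ∈ S
    · exact Finset.mem_union_left _ (Finset.mem_filter.2 ⟨Finset.mem_univ _, h⟩)
    · exact Finset.mem_union_right _ (Finset.mem_filter.2 ⟨Finset.mem_univ _, ⟨u.2, hu⟩,
        not_forall.1 h⟩)
  have hSc := Finset.card_le_card hSS
  rw [Finset.card_product, Finset.card_univ] at hSc
  have h4 := Finset.card_union_le F P
  calc S.card ≤ (F ∪ P).card * β := hSc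
    _ ≤ (11 * (G.interedges S Sᶜ).card) * β := Nat.mul_le_mul_right _ (by omega)
    _ = _ := by ring

end Host

/-! ### The stretched binary tree and its levels. -/

section Tree
variable {N M L : ℕ}

/-- The parent of a node in the heap numbering of the binary tree. -/
def heapParent (x : Fin N) : Fin N := ⟨x / 2, (Nat.div_le_self _ _).trans_lt x.2⟩

/-- The binary tree in which every edge is replaced by `M` parallel paths of length `L + 2`. -/
def treeGraph (N M L : ℕ) : SimpleGraph (Fin N × Spider (Fin M) L) :=
  spiderBundle fun x _ => (heapParent x, none)

/-- The distance of a vertex of a spider from its centre. -/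
def spiderPos {S : Type*} {K : ℕ} : Spider S K → ℕ
  | none => 0
  | some (_, j) => j + 1

lemma spiderPos_leg {S : Type*} {K : ℕ} (σ : S) {j : ℕ} (hj : j ≤ K + 1) :
    spiderPos (leg σ j : Spider S K) = j := by
  cases j with
  | zero => rfl
  | succ j =>
    simp only [leg, spiderPos, Fin.val_ofNat]
    rw [Nat.mod_eq_of_lt (by omega)]

/-- The height of a vertex of the tree above the root. -/
def treeLevel (u : Fin N × Spider (Fin M) L) : ℕ :=
  (L + 2) * Nat.log 2 u.1 - spiderPos u.2

/-- The vertices of the path number `a` from the node `x` to its parent. -/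
def treePath (x : Fin N) (a : Fin M) (j : ℕ) : Fin N × Spider (Fin M) L :=
  if j ≤ L + 1 then (x, leg a j) else (heapParent x, none)

/-- The edges of the path number `a` from the node `x` to its parent. -/
def treePathEdge (x : Fin N) (a : Fin M) (j : ℕ) : Sym2 (Fin N × Spider (Fin M) L) :=
  s(treePath x a j, treePath x a (j + 1))

lemma treeLevel_treePath (x : Fin N) (a : Fin M) {j : ℕ} (hj : j ≤ L + 2) :
    treeLevel (treePath x a j : Fin N × Spider (Fin M) L) = (L + 2) * Nat.log 2 x - j := by
  unfold treePath treeLevel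
  split_ifs with h
  · simp [spiderPos_leg a h]
  · have hj : j = L + 2 := by omega
    subst hj
    simp only [heapParent, spiderPos]
    rw [Nat.log_div_base, Nat.mul_sub_one]
    omega

lemma treeGraph_adj_treePath {x : Fin N} (hx : 1 ≤ (x : ℕ)) (a : Fin M) {j : ℕ}
    (hj : j ≤ L + 1) :
    (treeGraph N M L).Adj (treePath x a j) (treePath x a (j + 1)) := by
  unfold treePath
  rw [if_pos hj]
  split_ifs with h
  · exact spiderBundle_adj_leg _ x a (by omega)
  · have hj : j = L + 1 := by omega
    subst hj
    refine spiderBundle_adj_exit (fun x _ => (heapParent x, none)) x a fun h => ?_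
    have h1 := congrArg (fun u => (u.1 : ℕ)) h
    simp only [heapParent] at h1
    omega

lemma exists_treePath_of_adj {u v : Fin N × Spider (Fin M) L} (h : (treeGraph N M L).Adj u v) :
    ∃ x a j, j ≤ L + 1 ∧ ((u = treePath x a j ∧ v = treePath x a (j + 1)) ∨
      (v = treePath x a j ∧ u = treePath x a (j + 1))) := by
  obtain ⟨-, h⟩ := (SimpleGraph.fromRel_adj _ _ _).1 h
  have key : ∀ u v : Fin N × Spider (Fin M) L,
      ((∃ σ j, j ≤ L ∧ u.2 = leg σ j ∧ v = (u.1, leg σ (j + 1))) ∨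
      ∃ σ : Fin M, u.2 = leg σ (L + 1) ∧ v = (heapParent u.1, none)) →
      ∃ x a j, j ≤ L + 1 ∧ u = treePath x a j ∧ v = treePath x a (j + 1) := by
    rintro ⟨x, b⟩ v (⟨a, j, hj, hb, hv⟩ | ⟨a, hb, hv⟩)
    · refine ⟨x, a, j, by omega, ?_, ?_⟩
      · rw [treePath, if_pos (by omega), ← hb]
      · rw [treePath, if_pos (by omega), hv]
    · refine ⟨x, a, L + 1, le_rfl, ?_, ?_⟩
      · rw [treePath, if_pos le_rfl, ← hb]
      · rw [treePath, if_neg (by omega), hv]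
  rcases h with h | h
  · obtain ⟨x, a, j, hj, h1, h2⟩ := key u v h
    exact ⟨x, a, j, hj, Or.inl ⟨h1, h2⟩⟩
  · obtain ⟨x, a, j, hj, h1, h2⟩ := key v u h
    exact ⟨x, a, j, hj, Or.inr ⟨h1, h2⟩⟩

/-- Levels drop by one at each step towards the parent. Over the heap indices 0 and 1 truncated
subtraction makes every level 0, so the spurious node 0 does no harm. -/
lemma treeLevel_le_of_adj {u v : Fin N × Spider (Fin M) L} (h : (treeGraph N M L).Adj u v) :
    treeLevel u ≤ treeLevel v + 1 := by
  obtain ⟨x, a, j, hj, ⟨rfl, rfl⟩ | ⟨rfl, rfl⟩⟩ := exists_treePath_of_adj h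
  all_goals
    rw [treeLevel_treePath _ _ (by omega), treeLevel_treePath _ _ (by omega)]
    omega

/-- If the edges agree with the same orientation, their endpoints give the indices; at the centre,
common to all paths, the second endpoint identifies the path. Opposite orientations contradict the
drop in level, and 2 ≤ x prevents truncation there. -/
lemma treePathEdge_inj {x y : Fin N} {a b : Fin M} {i j : ℕ} (hx : 2 ≤ (x : ℕ))
    (hy : 2 ≤ (y : ℕ)) (hi : i ≤ L + 1) (hj : j ≤ L + 1)
    (h : (treePathEdge x a i : Sym2 (Fin N × Spider (Fin M) L)) = treePathEdge y b j) :
    x = y ∧ a = b ∧ i = j := by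
  have hlog : ∀ z : Fin N, 2 ≤ (z : ℕ) → L + 2 ≤ (L + 2) * Nat.log 2 z := fun z hz =>
    Nat.le_mul_of_pos_right _ (Nat.log_pos (by norm_num) hz)
  have hx' := hlog x hx
  have hy' := hlog y hy
  rcases Sym2.eq_iff.1 h with ⟨h1, h2⟩ | ⟨h1, h2⟩
  · have h3 := h1
    rw [treePath, treePath, if_pos hi, if_pos hj, Prod.mk.injEq] at h3
    obtain ⟨rfl, h3⟩ := h3
    refine ⟨rfl, ?_⟩
    rcases Nat.eq_zero_or_pos i with rfl | hi0
    · have hj0 : j = 0 := by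
        have := congrArg spiderPos h3
        rw [spiderPos_leg _ hi, spiderPos_leg _ hj] at this
        exact this.symm
      subst hj0
      rw [treePath, treePath, if_pos (by omega), if_pos (by omega), Prod.mk.injEq] at h2
      exact ⟨(leg_inj le_rfl (by omega) (by omega) h2.2).1, rfl⟩
    · exact leg_inj hi0 hi hj h3
  · have h3 := congrArg treeLevel h1
    have h4 := congrArg treeLevel h2
    rw [treeLevel_treePath _ _ (by omega), treeLevel_treePath _ _ (by omega)] at h3 h4
    omega

end Tree

/-! ### Percolation on the stretched tree. -/

section TreePercolation
variable {N M L : ℕ} {V : Type*} (ι : Fin N × Spider (Fin M) L ↪ V)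

/-- The event that one of the parallel paths from the node `x` to its parent is open. -/
def treeLink (x : ℕ) : Set (SimpleGraph V) :=
  if h : 2 ≤ x ∧ x < N then
    {H | ∃ a, ∀ j ≤ L + 1, Sym2.map ι (treePathEdge ⟨x, h.2⟩ a j) ∈ H.edgeSet}
  else Set.univ

/-- The edges on the parallel paths from the node `x` to its parent. -/
def treeLinkEdges (x : ℕ) : Set (Sym2 V) :=
  {e | ∃ h : x < N, 2 ≤ x ∧ ∃ a j, j ≤ L + 1 ∧ e = Sym2.map ι (treePathEdge ⟨x, h⟩ a j)}

lemma treeLinkEdges_disjoint {x y : ℕ} (hxy : x ≠ y) :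
    Disjoint (treeLinkEdges ι x) (treeLinkEdges ι y) := by
  rw [Set.disjoint_left]
  rintro e ⟨h1, hx, a, i, hi, rfl⟩ ⟨h2, hy, b, j, hj, h⟩
  have := treePathEdge_inj (x := ⟨x, h1⟩) (y := ⟨y, h2⟩) hx hy hi hj
    (Sym2.map.injective ι.injective h)
  exact hxy (congrArg Fin.val this.1)

lemma measurableSet_forall_mem_edgeSet {S : Set (Sym2 V)} (n : ℕ) (e : ℕ → Sym2 V)
    (he : ∀ j ≤ n, e j ∈ S) :
    MeasurableSet[eventSigma (fun e : Sym2 V => {H : SimpleGraph V | e ∈ H.edgeSet}) S]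
      {H | ∀ j ≤ n, e j ∈ H.edgeSet} := by
  have h1 : {H : SimpleGraph V | ∀ j ≤ n, e j ∈ H.edgeSet} =
      ⋂ j ∈ Finset.range (n + 1), {H | e j ∈ H.edgeSet} := by
    ext H; simp
  rw [h1]
  refine Finset.measurableSet_biInter _ fun j hj => ?_
  exact measurableSet_eventSigma (s := fun e : Sym2 V => {H : SimpleGraph V | e ∈ H.edgeSet})
    (he j (by rw [Finset.mem_range] at hj; omega))

lemma measurableSet_treeLink (x : ℕ) :
    MeasurableSet[eventSigma (fun e : Sym2 V => {H : SimpleGraph V | e ∈ H.edgeSet})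
      (treeLinkEdges ι x)] (treeLink ι x) := by
  unfold treeLink
  split_ifs with h
  · have h1 : {H : SimpleGraph V |
        ∃ a, ∀ j ≤ L + 1, Sym2.map ι (treePathEdge ⟨x, h.2⟩ a j) ∈ H.edgeSet} =
        ⋃ a, {H | ∀ j ≤ L + 1, Sym2.map ι (treePathEdge ⟨x, h.2⟩ a j) ∈ H.edgeSet} := by
      ext H; simp
    rw [h1]
    exact MeasurableSet.iUnion fun a => measurableSet_forall_mem_edgeSet _ _
      fun j hj => ⟨h.2, h.1, a, j, hj, rfl⟩
  · exact MeasurableSet.univ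

lemma exists_reachable_of_survives {H : SimpleGraph V} (n : ℕ) (x : Fin N) (hx : 1 ≤ (x : ℕ))
    (hN : ((x : ℕ) + 1) * 2 ^ n ≤ N) (h : H ∈ survives (treeLink ι) n x) :
    ∃ y : Fin N, Nat.log 2 y = Nat.log 2 x + n ∧ H.Reachable (ι (x, none)) (ι (y, none)) := by
  induction n generalizing x with
  | zero => exact ⟨x, rfl, .rfl⟩
  | succ n ih =>
    have key : ∀ z : ℕ, z / 2 = x → H ∈ treeLink ι z ∩ survives (treeLink ι) n z →
        ∃ y : Fin N, Nat.log 2 y = Nat.log 2 x + (n + 1) ∧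
          H.Reachable (ι (x, none)) (ι (y, none)) := by
      rintro z hz ⟨h1, h2⟩
      have hzN : (z + 1) * 2 ^ n ≤ N := by
        refine le_trans ?_ hN
        rw [pow_succ']
        nlinarith [Nat.two_pow_pos n, show z + 1 ≤ ((x : ℕ) + 1) * 2 by omega]
      have hzN' : z < N := by
        have : 1 ≤ 2 ^ n := Nat.one_le_two_pow
        nlinarith
      obtain ⟨y, hy, hr⟩ := ih ⟨z, hzN'⟩ (show 1 ≤ z by omega) hzN h2
      refine ⟨y, ?_, ?_⟩
      · have h3 : Nat.log 2 z = Nat.log 2 x + 1 := by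
          rw [Nat.log_of_one_lt_of_le (by norm_num) (by omega), hz]
        simp only at hy
        omega
      · rw [treeLink, dif_pos ⟨by omega, hzN'⟩] at h1
        obtain ⟨a, ha⟩ := h1
        have hpath : ∀ j ≤ L + 2, H.Reachable (ι (⟨z, hzN'⟩, none))
            (ι (treePath ⟨z, hzN'⟩ a j)) := by
          intro j
          induction j with
          | zero => intro _; simp [treePath]
          | succ j ihj =>
            intro hj
            exact (ihj (by omega)).trans (SimpleGraph.Adj.reachable
              (by simpa [treePathEdge] using ha j (by omega)))
        have h4 := hpath (L + 2) le_rfl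
        rw [treePath, if_neg (by omega)] at h4
        have h5 : heapParent (⟨z, hzN'⟩ : Fin N) = x := Fin.ext hz
        rw [h5] at h4
        exact h4.symm.trans hr
    rcases h with h | h
    · exact key _ (by omega) h
    · exact key _ (by omega) h

variable [Finite V] (G : SimpleGraph V) (p : unitInterval)

/-- The M paths are edge-disjoint, so they are open independently, each with probability p^(L+2). -/
lemma le_measureReal_treeLink (hG : (treeGraph N M L).map ι ≤ G) {x : ℕ} (hx : 2 ≤ x)
    (hxN : x < N) :
    1 - (1 - (p : ℝ) ^ (L + 2)) ^ M ≤ (percolation G p).real (treeLink ι x) := by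
  set E : Fin M → Set (SimpleGraph V) := fun a =>
    {H | ∀ j ≤ L + 1, Sym2.map ι (treePathEdge ⟨x, hxN⟩ a j) ∈ H.edgeSet} with hE
  have h1 : treeLink ι x = (⋂ a ∈ (Finset.univ : Finset (Fin M)), (E a)ᶜ)ᶜ := by
    rw [treeLink, dif_pos ⟨hx, hxN⟩]
    ext H; simp [hE]
  have hEp : ∀ a, (percolation G p).real (E a) = (p : ℝ) ^ (L + 2) := by
    classical
    intro a
    have h2 : E a = {H | ∀ e ∈ (Finset.range (L + 2)).image
        (fun j => Sym2.map ι (treePathEdge (⟨x, hxN⟩ : Fin N) a j)), e ∈ H.edgeSet} := by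
      ext H; simp [hE, Nat.lt_succ_iff]
    rw [h2, percolation_real_forall_mem, Finset.card_image_of_injOn, Finset.card_range]
    · intro i hi j hj hij
      rw [Finset.coe_range, Set.mem_Iio] at hi hj
      exact (treePathEdge_inj (x := ⟨x, hxN⟩) (y := ⟨x, hxN⟩) hx hx (by omega) (by omega)
        (Sym2.map.injective ι.injective hij)).2.2
    · intro e he
      obtain ⟨j, hj, rfl⟩ := Finset.mem_image.1 he
      rw [Finset.mem_range] at hj
      have hadj := treeGraph_adj_treePath (M := M) (L := L) (x := ⟨x, hxN⟩)
        (show 1 ≤ x by omega) a (j := j) (by omega)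
      exact hG (SimpleGraph.map_adj_apply.2 hadj)
  set F : Fin M → Set (Sym2 V) := fun a =>
    {e | ∃ j ≤ L + 1, e = Sym2.map ι (treePathEdge ⟨x, hxN⟩ a j)} with hF
  have hEm : ∀ a, MeasurableSet[eventSigma (fun e : Sym2 V => {H : SimpleGraph V | e ∈ H.edgeSet})
      (F a)] (E a) := fun a => measurableSet_forall_mem_edgeSet _ _ fun j hj => ⟨j, hj, rfl⟩
  have hind := measureReal_biInter_of_disjoint (fun _ => .of_discrete) (percolation_iIndepSet G p)
    F (fun a => (E a)ᶜ) (fun a => (hEm a).compl) Finset.univ (by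
      intro a _ b _ hab
      rw [Set.disjoint_left]
      rintro e ⟨i, hi, rfl⟩ ⟨j, hj, h⟩
      exact hab (treePathEdge_inj (x := ⟨x, hxN⟩) (y := ⟨x, hxN⟩) hx hx hi hj
        (Sym2.map.injective ι.injective h)).2.1)
  have hEc : ∀ a, (percolation G p).real (E a)ᶜ = 1 - (p : ℝ) ^ (L + 2) := fun a => by
    rw [probReal_compl_eq_one_sub .of_discrete, hEp]
  rw [h1, probReal_compl_eq_one_sub .of_discrete, hind]
  simp [hEc]

/-- With probability close to one, percolation on the tree reaches its top level. -/
lemma le_measureReal_reach_top {t : ℕ} (ι : Fin (2 ^ (t + 1)) × Spider (Fin M) L ↪ V)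
    (hG : (treeGraph (2 ^ (t + 1)) M L).map ι ≤ G) {e : ℝ} (he0 : 0 ≤ e) (he : e ≤ 1 / 4)
    (hM : (1 - (p : ℝ) ^ (L + 2)) ^ M ≤ e) (x : Fin (2 ^ (t + 1))) (hx : (x : ℕ) = 1) :
    1 - e ≤ (percolation G p).real {H | ∃ y : Fin (2 ^ (t + 1)), Nat.log 2 y = t ∧
      H.Reachable (ι (x, none)) (ι (y, none))} := by
  have h1 := measureReal_survives (μ := percolation G p) (fun _ => .of_discrete)
    (percolation_iIndepSet G p)
    (F := treeLinkEdges ι) (link := treeLink ι) (fun x y => treeLinkEdges_disjoint ι)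
    (measurableSet_treeLink ι) he0 he (N := 2 ^ (t + 1))
    (fun z hz hzN => le_trans (by linarith) (le_measureReal_treeLink ι G p hG hz hzN)) t 1 le_rfl
    (by rw [pow_succ'])
  refine h1.trans (measureReal_mono ?_)
  intro H hH
  obtain ⟨y, hy, hr⟩ := exists_reachable_of_survives ι t x hx.ge
    (by rw [hx, pow_succ']) (by rw [hx]; exact hH)
  exact ⟨y, by simpa [hx] using hy, hr⟩

end TreePercolation

/-! ### Confinement of open host paths by bad points. -/

section BadPoints
variable {Y : Type*} (π : Fin 8 → Equiv.Perm Y) {K : ℕ}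

/-- The points of `Y` over which some leg is completely open. -/
def badPoints (H : SimpleGraph (Y × Spider Letter K)) : Set Y :=
  {y | ∃ σ : Letter, ∀ j ≤ K, H.Adj (y, leg σ j) (y, leg σ (j + 1))}

/-- There is a path of `t` distinct bad points. -/
def HasBadPath (H : SimpleGraph (Y × Spider Letter K)) (t : ℕ) : Prop :=
  ∃ f : ℕ → Y, Set.InjOn f (Set.Iio t) ∧ (∀ i < t, f i ∈ badPoints H) ∧
    ∀ i, i + 1 < t → ∃ σ, f (i + 1) = letterPerm π σ (f i)

/-- The points that can be reached from `y` through bad points. -/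
def BadReach (H : SimpleGraph (Y × Spider Letter K)) (y : Y) : Y → Prop :=
  Relation.ReflTransGen (fun a b => b ∈ badPoints H ∧ ∃ σ, b = letterPerm π σ a) y

/-- The graph of moves between bad points and the point `y`. -/
def badGraph (H : SimpleGraph (Y × Spider Letter K)) (y : Y) : SimpleGraph Y :=
  SimpleGraph.fromRel fun a b =>
    a ∈ insert y (badPoints H) ∧ b ∈ insert y (badPoints H) ∧ ∃ σ, b = letterPerm π σ a

variable {π} {H : SimpleGraph (Y × Spider Letter K)}

lemma badGraph_adj {y a b : Y} (h : (badGraph π H y).Adj a b) :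
    b ∈ insert y (badPoints H) ∧ ∃ σ, b = letterPerm π σ a := by
  obtain ⟨-, ⟨-, h1, h2⟩ | ⟨h1, -, σ, rfl⟩⟩ := (SimpleGraph.fromRel_adj _ _ _).1 h
  · exact ⟨h1, h2⟩
  · exact ⟨h1, σ.opp, (letterPerm_opp_apply π σ b).symm⟩

lemma BadReach.reachable {y z : Y} (h : BadReach π H y z) : (badGraph π H y).Reachable y z := by
  have key : z ∈ insert y (badPoints H) ∧ (badGraph π H y).Reachable y z := by
    induction h with
    | refl => exact ⟨Set.mem_insert _ _, .rfl⟩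
    | @tail b c _ hbc ih =>
      refine ⟨Set.mem_insert_of_mem _ hbc.1, ?_⟩
      by_cases hne : b = c
      · exact hne ▸ ih.2
      · exact ih.2.trans (SimpleGraph.Adj.reachable ((SimpleGraph.fromRel_adj _ _ _).2
          ⟨hne, Or.inl ⟨ih.1, Set.mem_insert_of_mem _ hbc.1, hbc.2⟩⟩))
  exact key.2

lemma mem_wordBall_of_walk [DecidableEq Y] {y a : Y}
    (w : (badGraph π H y).Walk y a) : a ∈ wordBall π y w.length := by
  have key : ∀ i ≤ w.length, w.getVert i ∈ wordBall π y i := by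
    intro i
    induction i with
    | zero => intro _; simp [wordBall]
    | succ i ih =>
      intro hi
      obtain ⟨-, σ, hσ⟩ := badGraph_adj (w.adj_getVert_succ (show i < w.length by omega))
      rw [hσ]
      exact mem_wordBall_succ π (ih (by omega)) σ
  simpa using key w.length le_rfl

/-- A simple path of length at least t in `badGraph`, stripped of its starting point `y` (which need
not be bad), would supply t distinct bad points. -/
lemma BadReach.mem_wordBall [DecidableEq Y] {t : ℕ} (ht : ¬ HasBadPath π H t) {y z : Y}
    (h : BadReach π H y z) : z ∈ wordBall π y t := by
  obtain ⟨w, hw⟩ := h.reachable.exists_isPath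
  by_contra hcon
  have hlen : t ≤ w.length := by
    by_contra hlt
    exact hcon (wordBall_mono π y (by omega) (mem_wordBall_of_walk w))
  refine ht ⟨fun i => w.getVert (i + 1), ?_, ?_, ?_⟩
  · intro i hi j hj hij
    rw [Set.mem_Iio] at hi hj
    have := hw.getVert_injOn (show i + 1 ≤ w.length by omega) (show j + 1 ≤ w.length by omega) hij
    omega
  · intro i hi
    have h1 := (badGraph_adj (w.adj_getVert_succ (show i < w.length by omega))).1
    refine h1.resolve_left fun h2 => ?_
    have := hw.getVert_injOn (show i + 1 ≤ w.length by omega) (show 0 ≤ w.length by omega)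
      (by simpa using h2)
    omega
  · intro i hi
    exact (badGraph_adj (w.adj_getVert_succ (show i + 1 < w.length by omega))).2

/-- The set of vertices that open paths from the points reached through bad points can enter. -/
def openRegion (π : Fin 8 → Equiv.Perm Y) (H : SimpleGraph (Y × Spider Letter K)) (y : Y) :
    Set (Y × Spider Letter K) :=
  {u | BadReach π H y u.1 ∨ ∃ σ j, 1 ≤ j ∧ j ≤ K + 1 ∧ u.2 = leg σ j ∧
    BadReach π H y (letterPerm π σ u.1) ∧
    ∀ i, j ≤ i → i ≤ K → H.Adj (u.1, leg σ i) (u.1, leg σ (i + 1))}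

/-- An open edge out of a reached fibre ends at the tip of a leg over a neighbouring point. From
there a path can only descend the open part of that leg; if it arrives at the centre, the whole leg
is open, so the neighbouring point is bad and is itself reached. -/
lemma mem_openRegion_of_adj {y : Y} {u v : Y × Spider Letter K} (hu : u ∈ openRegion π H y)
    (hH : H.Adj u v) (hX : (hostGraph π K).Adj u v) : v ∈ openRegion π H y := by
  obtain ⟨-, hX⟩ := (SimpleGraph.fromRel_adj _ _ _).1 hX
  rcases hu with hu | ⟨σ, j, hj1, hjK, huσ, hreach, hopen⟩
  · rcases hX with (⟨τ, i, hi, -, rfl⟩ | ⟨τ, -, rfl⟩) | (⟨τ, i, hi, -, rfl⟩ | ⟨τ, h1, rfl⟩)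
    · exact Or.inl hu
    · refine Or.inr ⟨τ.opp, K + 1, by omega, le_rfl, rfl, ?_, fun i h1 h2 => by omega⟩
      rwa [letterPerm_opp_apply]
    · exact Or.inl hu
    · exact Or.inr ⟨τ, K + 1, by omega, le_rfl, h1, hu, fun i h1 h2 => by omega⟩
  · rcases hX with (⟨τ, i, hi, h1, rfl⟩ | ⟨τ, h1, rfl⟩) | (⟨τ, i, hi, h1, rfl⟩ | ⟨τ, h1, rfl⟩)
    · obtain ⟨rfl, rfl⟩ := leg_inj hj1 hjK (by omega) (huσ.symm.trans h1)
      exact Or.inr ⟨σ, j + 1, by omega, by omega, rfl, hreach, fun i h2 h3 => hopen i (by omega) h3⟩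
    · obtain ⟨rfl, -⟩ := leg_inj hj1 hjK (by omega) (huσ.symm.trans h1)
      exact Or.inl hreach
    · have huσ' : (leg σ j : Spider Letter K) = leg τ (i + 1) := huσ.symm
      obtain ⟨rfl, rfl⟩ := leg_inj hj1 hjK (by omega) huσ'
      have hopen' : ∀ i', i ≤ i' → i' ≤ K → H.Adj (v.1, leg σ i') (v.1, leg σ (i' + 1)) := by
        intro i' h2 h3
        rcases h2.eq_or_lt with rfl | h2
        · rw [← h1]; exact hH.symm
        · exact hopen i' h2 h3
      rcases Nat.eq_zero_or_pos i with rfl | hi0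
      · refine Or.inl (hreach.tail ⟨⟨σ, fun j hj => hopen' j (by omega) hj⟩, σ.opp, ?_⟩)
        exact (letterPerm_opp_apply π σ v.1).symm
      · exact Or.inr ⟨σ, i, hi0, by omega, h1, hreach, hopen'⟩
    · have huσ' : (leg σ j : Spider Letter K) = leg τ.opp (K + 1) := huσ.symm
      obtain ⟨rfl, -⟩ := leg_inj hj1 hjK (by omega) huσ'
      refine Or.inl ?_
      have h2 : BadReach π H y (letterPerm π τ.opp (letterPerm π τ v.1)) := hreach
      rwa [letterPerm_opp_apply] at h2

/-- The extra letter in t + 1 accounts for ending inside a leg over a neighbour of a reached point.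
-/
lemma mem_wordBall_of_reachable [DecidableEq Y] {t : ℕ} (ht : ¬ HasBadPath π H t)
    {u v : Y × Spider Letter K} (h : (H ⊓ hostGraph π K).Reachable u v) :
    v.1 ∈ wordBall π u.1 (t + 1) := by
  have hmem : v ∈ openRegion π H u.1 := by
    obtain ⟨w⟩ := h
    have key : ∀ {a b} (w : (H ⊓ hostGraph π K).Walk a b), a ∈ openRegion π H u.1 →
        b ∈ openRegion π H u.1 := by
      intro a b w
      induction w with
      | nil => exact id
      | cons hadj _ ih => exact fun ha => ih (mem_openRegion_of_adj ha hadj.1 hadj.2)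
    exact key w (Or.inl .refl)
  rcases hmem with h1 | ⟨σ, j, -, -, -, h1, -⟩
  · exact wordBall_mono π _ (Nat.le_succ t) (h1.mem_wordBall ht)
  · have h2 := mem_wordBall_succ π (h1.mem_wordBall ht) σ.opp
    rwa [letterPerm_opp_apply] at h2

end BadPoints

/-! ### Union bound for bad paths. -/

section BadPathProbability
variable {Y : Type*} (π : Fin 8 → Equiv.Perm Y) {K : ℕ}

/-- The points visited when reading the word `w` from `y`. -/
def wordOrbit {t : ℕ} (y : Y) (w : Fin t → Letter) : ℕ → Y
  | 0 => y
  | i + 1 => letterPerm π (if h : i < t then w ⟨i, h⟩ else none) (wordOrbit y w i)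

lemma HasBadPath.exists_word {H : SimpleGraph (Y × Spider Letter K)} {t : ℕ}
    (h : HasBadPath π H (t + 1)) :
    ∃ (y : Y) (w σ : Fin (t + 1) → Letter), Set.InjOn (wordOrbit π y w) (Set.Iio (t + 1)) ∧
      ∀ i : Fin (t + 1), ∀ j ≤ K,
        H.Adj (wordOrbit π y w i, leg (σ i) j) (wordOrbit π y w i, leg (σ i) (j + 1)) := by
  obtain ⟨f, hinj, hbad, hstep⟩ := h
  have h1 : ∀ i : Fin (t + 1), ∃ σ, (i : ℕ) + 1 < t + 1 → f (i + 1) = letterPerm π σ (f i) := by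
    intro i
    by_cases hi : (i : ℕ) + 1 < t + 1
    · obtain ⟨σ, hσ⟩ := hstep i hi
      exact ⟨σ, fun _ => hσ⟩
    · exact ⟨none, fun h => absurd h hi⟩
  choose w hw using h1
  have h2 : ∀ i < t + 1, wordOrbit π (f 0) w i = f i := by
    intro i
    induction i with
    | zero => intro _; rfl
    | succ i ih =>
      intro hi
      rw [wordOrbit, dif_pos (by omega), ih (by omega)]
      exact (hw ⟨i, by omega⟩ hi).symm
  choose σ hσ using fun i : Fin (t + 1) => hbad i i.2
  refine ⟨f 0, w, σ, fun i hi j hj hij => hinj hi hj ?_, fun i j hj => ?_⟩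
  · rwa [h2 i hi, h2 j hj] at hij
  · rw [h2 i i.2]
    exact hσ i j hj

lemma legEdge_inj {S : Type*} {x y : Y} {σ τ : S} {i j : ℕ} (hi : i ≤ K) (hj : j ≤ K)
    (h : s((x, (leg σ i : Spider S K)), (x, leg σ (i + 1))) =
      s((y, (leg τ j : Spider S K)), (y, leg τ (j + 1)))) : x = y ∧ σ = τ ∧ i = j := by
  rcases Sym2.eq_iff.1 h with ⟨-, h2⟩ | ⟨h1, h2⟩
  · rw [Prod.mk.injEq] at h2
    have := leg_inj (by omega) (by omega) (by omega) h2.2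
    exact ⟨h2.1, this.1, by omega⟩
  · rw [Prod.mk.injEq] at h1 h2
    have h3 := congrArg spiderPos h1.2
    have h4 := congrArg spiderPos h2.2
    rw [spiderPos_leg _ (by omega), spiderPos_leg _ (by omega)] at h3 h4
    omega

/-- Union bound over the starting point, 17^t words and 17^t choices of an open leg at each visited
point. Since the points are distinct, t(K+1) different edges must be open. -/
lemma measureReal_hasBadPath_le [Fintype Y] (G : SimpleGraph (Y × Spider Letter K))
    (hG : hostGraph π K ≤ G) (p : unitInterval) {t : ℕ} (ht : 1 ≤ t) :
    (percolation G p).real {H | HasBadPath π H t} ≤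
      Fintype.card Y * (17 * 17 * (p : ℝ) ^ (K + 1)) ^ t := by
  classical
  obtain ⟨t, rfl⟩ := Nat.exists_eq_add_of_le' ht
  set E : Y × (Fin (t + 1) → Letter) × (Fin (t + 1) → Letter) → Set (SimpleGraph _) := fun x =>
    {H | Set.InjOn (wordOrbit π x.1 x.2.1) (Set.Iio (t + 1)) ∧ ∀ i : Fin (t + 1), ∀ j ≤ K,
      H.Adj (wordOrbit π x.1 x.2.1 i, leg (x.2.2 i) j)
        (wordOrbit π x.1 x.2.1 i, leg (x.2.2 i) (j + 1))} with hE
  have hsub : {H | HasBadPath π H (t + 1)} ⊆ ⋃ x, E x := by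
    intro H hH
    obtain ⟨y, w, σ, h1, h2⟩ := HasBadPath.exists_word π hH
    exact Set.mem_iUnion.2 ⟨(y, w, σ), h1, h2⟩
  have hEp : ∀ x, (percolation G p).real (E x) ≤ ((p : ℝ) ^ (K + 1)) ^ (t + 1) := by
    rintro ⟨y, w, σ⟩
    by_cases hinj : Set.InjOn (wordOrbit π y w) (Set.Iio (t + 1))
    · set F : Finset (Sym2 (Y × Spider Letter K)) :=
        ((Finset.univ : Finset (Fin (t + 1))) ×ˢ Finset.range (K + 1)).image fun ij =>
          s((wordOrbit π y w ij.1, leg (σ ij.1) ij.2),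
            (wordOrbit π y w ij.1, leg (σ ij.1) (ij.2 + 1))) with hF
      have h1 : E (y, w, σ) ⊆ {H | ∀ e ∈ F, e ∈ H.edgeSet} := by
        rintro H ⟨-, hH⟩ e he
        obtain ⟨⟨i, j⟩, hij, rfl⟩ := Finset.mem_image.1 he
        rw [Finset.mem_product, Finset.mem_range] at hij
        exact hH i j (by omega)
      refine (measureReal_mono h1).trans ?_
      rw [percolation_real_forall_mem, hF, Finset.card_image_of_injOn]
      · rw [Finset.card_product, Finset.card_range, Finset.card_univ, Fintype.card_fin, ← pow_mul,
          mul_comm]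
      · rintro ⟨i, j⟩ hi ⟨i', j'⟩ hi' h
        rw [Finset.mem_coe, Finset.mem_product, Finset.mem_range] at hi hi'
        obtain ⟨h2, -, h3⟩ := legEdge_inj (by omega) (by omega) h
        exact Prod.ext (Fin.ext (hinj i.2 i'.2 h2)) h3
      · intro e he
        obtain ⟨⟨i, j⟩, hij, rfl⟩ := Finset.mem_image.1 he
        rw [Finset.mem_product, Finset.mem_range] at hij
        exact hG (spiderBundle_adj_leg _ _ _ (by omega))
    · have h1 : E (y, w, σ) = ∅ := by
        ext H; simp [hE, hinj]
      rw [h1, measureReal_empty]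
      have := p.2.1
      positivity
  calc (percolation G p).real {H | HasBadPath π H (t + 1)}
      ≤ (percolation G p).real (⋃ x, E x) := measureReal_mono hsub
    _ ≤ ∑ x, (percolation G p).real (E x) := measureReal_iUnion_fintype_le _
    _ ≤ ∑ x : Y × (Fin (t + 1) → Letter) × (Fin (t + 1) → Letter),
        ((p : ℝ) ^ (K + 1)) ^ (t + 1) := Finset.sum_le_sum fun x _ => hEp x
    _ = _ := by
      rw [Finset.sum_const, Finset.card_univ, nsmul_eq_mul]
      simp only [Fintype.card_prod, Fintype.card_fun, Fintype.card_fin, Fintype.card_option,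
        Fintype.card_bool]
      push_cast
      rw [mul_pow, mul_pow, mul_assoc]

end BadPathProbability

/-! ### Attaching the tree at well separated tips. -/

section Attachment
variable {Y W : Type*} (π : Fin 8 → Equiv.Perm Y) {K : ℕ}

/-- The embedding that places `w` at the free tip over `φ w`. -/
def tipEmbedding (K : ℕ) (φ : W ↪ Y) : W ↪ Y × Spider Letter K :=
  ⟨fun w => (φ w, leg none (K + 1)), fun _ _ h => φ.injective (Prod.ext_iff.1 h).1⟩

/-- The subdivided expander with a graph on `W` attached at the free tips. -/
def attachedGraph (π : Fin 8 → Equiv.Perm Y) (K : ℕ) (T : SimpleGraph W) (φ : W ↪ Y) :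
    SimpleGraph (Y × Spider Letter K) :=
  hostGraph π K ⊔ T.map (tipEmbedding K φ)

lemma attachedGraph_adj_cases {Y W : Type*} {π : Fin 8 → Equiv.Perm Y} {K : ℕ} {T : SimpleGraph W}
    {φ : W ↪ Y} {H : SimpleGraph (Y × Spider Letter K)} (hH : H ≤ attachedGraph π K T φ)
    {a b : Y × Spider Letter K}
    (h : H.Adj a b) : (H ⊓ hostGraph π K).Adj a b ∨
      ∃ w w', T.Adj w w' ∧ a = tipEmbedding K φ w ∧ b = tipEmbedding K φ w' := by
  rcases hH h with h1 | h1
  · exact Or.inl ⟨h, h1⟩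
  · obtain ⟨w, w', h2, h3, h4⟩ := (SimpleGraph.map_adj _ _ _ _).1 h1
    exact Or.inr ⟨w, w', h2, h3.symm, h4.symm⟩

variable [DecidableEq Y]

/-- No two of the points `φ w` are joined by words of length `r` in both directions. -/
def WordSeparated (φ : W → Y) (r : ℕ) : Prop :=
  ∀ w w', w ≠ w' → φ w' ∈ wordBall π (φ w) r → φ w ∉ wordBall π (φ w') r

/-- Greedy choice: each new point avoids the balls around the earlier ones. Because separation
forbids only mutual membership, nothing is needed about the ball around the new point. -/
lemma exists_wordSeparated [Fintype W] [Fintype Y] {r : ℕ}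
    (h : Fintype.card W * 17 ^ r ≤ Fintype.card Y) : ∃ φ : W → Y, WordSeparated π φ r := by
  classical
  have key : ∀ A : Finset W, ∃ φ : W → Y, ∀ w ∈ A, ∀ w' ∈ A, w ≠ w' →
      φ w' ∈ wordBall π (φ w) r → φ w ∉ wordBall π (φ w') r := by
    intro A
    induction A using Finset.induction_on with
    | empty =>
      rcases isEmpty_or_nonempty W with hW | ⟨⟨w⟩⟩
      · exact ⟨fun w => isEmptyElim w, by simp⟩
      · have : 0 < Fintype.card Y :=
          lt_of_lt_of_le (Nat.mul_pos (Fintype.card_pos_iff.2 ⟨w⟩) (by positivity)) h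
        obtain ⟨y⟩ := Fintype.card_pos_iff.1 this
        exact ⟨fun _ => y, by simp⟩
    | insert a A ha ih =>
      obtain ⟨φ, hφ⟩ := ih
      have hcard : (A.biUnion fun w => wordBall π (φ w) r).card < Fintype.card Y := by
        refine lt_of_le_of_lt (Finset.card_biUnion_le_card_mul _ _ (17 ^ r)
          fun w _ => card_wordBall_le π _ r) (lt_of_lt_of_le ?_ h)
        refine Nat.mul_lt_mul_of_pos_right ?_ (by positivity)
        exact Finset.card_lt_univ_of_notMem ha
      obtain ⟨y, hy⟩ : ∃ y, y ∉ A.biUnion fun w => wordBall π (φ w) r := by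
        by_contra hcon
        push Not at hcon
        rw [Finset.eq_univ_iff_forall.2 hcon, Finset.card_univ] at hcard
        exact lt_irrefl _ hcard
      have hy' : ∀ w ∈ A, y ∉ wordBall π (φ w) r := fun w hw hyw =>
        hy (Finset.mem_biUnion.2 ⟨w, hw, hyw⟩)
      have hne : ∀ w ∈ A, w ≠ a := fun w hw hwa => ha (hwa ▸ hw)
      refine ⟨Function.update φ a y, fun w hw w' hw' hww' => ?_⟩
      rcases Finset.mem_insert.1 hw with rfl | hwA <;>
        rcases Finset.mem_insert.1 hw' with rfl | hwA'
      · exact absurd rfl hww'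
      · rw [Function.update_self, Function.update_of_ne (hne w' hwA')]
        exact fun _ => hy' w' hwA'
      · rw [Function.update_self, Function.update_of_ne (hne w hwA)]
        exact fun h1 _ => hy' w hwA h1
      · rw [Function.update_of_ne (hne w hwA), Function.update_of_ne (hne w' hwA')]
        exact hφ w hwA w' hwA' hww'
  obtain ⟨φ, hφ⟩ := key Finset.univ
  exact ⟨φ, fun w w' => hφ w (Finset.mem_univ _) w' (Finset.mem_univ _)⟩

variable {π}

lemma mem_wordBall_self (y : Y) (r : ℕ) : y ∈ wordBall π y r :=
  wordBall_mono π y (Nat.zero_le r) (by simp [wordBall])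

lemma WordSeparated.injective {φ : W → Y} {r : ℕ} (h : WordSeparated π φ r) :
    Function.Injective φ := by
  intro w w' hww'
  by_contra hne
  exact h w w' hne (hww' ▸ mem_wordBall_self _ _) (hww' ▸ mem_wordBall_self _ _)

variable {T : SimpleGraph W} {φ : W ↪ Y} {H : SimpleGraph (Y × Spider Letter K)} {t : ℕ}

/-- Reachability is symmetric, so confinement yields ball membership in both directions, which
separation rules out. -/
lemma eq_of_tips_reachable (ht : ¬ HasBadPath π H t) (hφ : WordSeparated π φ (t + 1)) {w w' : W}
    (h : (H ⊓ hostGraph π K).Reachable (tipEmbedding K φ w) (tipEmbedding K φ w')) : w = w' := by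
  by_contra hne
  exact hφ w w' hne (mem_wordBall_of_reachable ht h) (mem_wordBall_of_reachable ht h.symm)

/-- Open walks between attached vertices are no shorter than the difference of their levels. -/
lemma level_le_of_walk (hH : H ≤ attachedGraph π K T φ) (ht : ¬ HasBadPath π H t)
    (hφ : WordSeparated π φ (t + 1)) (lev : W → ℕ)
    (hlev : ∀ w w', T.Adj w w' → lev w' ≤ lev w + 1) {w₀ w₁ : W}
    (p : H.Walk (tipEmbedding K φ w₀) (tipEmbedding K φ w₁)) : lev w₁ ≤ lev w₀ + p.length := by
  have key : ∀ {a b} (p : H.Walk a b) (w₀ w₁ : W),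
      (H ⊓ hostGraph π K).Reachable (tipEmbedding K φ w₀) a →
      (H ⊓ hostGraph π K).Reachable (tipEmbedding K φ w₁) b → lev w₁ ≤ lev w₀ + p.length := by
    intro a b p
    induction p with
    | nil =>
      intro w₀ w₁ h0 h1
      rw [eq_of_tips_reachable ht hφ (h0.trans h1.symm)]
      simp
    | cons hadj p ih =>
      intro w₀ w₁ h0 h1
      rw [SimpleGraph.Walk.length_cons]
      -- Invariant: the current vertex lies in the open host cluster of the tip of `w₀`. A host edge
      -- stays in that cluster; a tree edge starts at a tip, necessarily that of `w₀`, and changes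
      -- the level by at most one.
      rcases attachedGraph_adj_cases hH hadj with hQ | ⟨w, w', hT, rfl, rfl⟩
      · have := ih w₀ w₁ (h0.trans hQ.reachable) h1
        omega
      · have h2 := eq_of_tips_reachable ht hφ h0
        subst h2
        have h3 := ih w' w₁ .rfl h1
        have h4 := hlev _ _ hT
        omega
  exact key p w₀ w₁ .rfl .rfl

/-- A component is covered by the open host clusters of its starting vertex and of the attached
tips, each lying over a word ball. -/
lemma ncard_reachable_le [Fintype Y] [Fintype W] (hH : H ≤ attachedGraph π K T φ)
    (ht : ¬ HasBadPath π H t) (u : Y × Spider Letter K) :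
    {v | H.Reachable u v}.ncard ≤
      (Fintype.card W + 1) * (17 ^ (t + 1) * Fintype.card (Spider Letter K)) := by
  classical
  set region : Y × Spider Letter K → Finset (Y × Spider Letter K) := fun a =>
    wordBall π a.1 (t + 1) ×ˢ Finset.univ with hregion
  have hcard : ∀ a, (region a).card ≤ 17 ^ (t + 1) * Fintype.card (Spider Letter K) := fun a => by
    rw [hregion, Finset.card_product, Finset.card_univ]
    exact Nat.mul_le_mul_right _ (card_wordBall_le π _ _)
  have hreg : ∀ a b, (H ⊓ hostGraph π K).Reachable a b → b ∈ region a := fun a b h =>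
    Finset.mem_product.2 ⟨mem_wordBall_of_reachable ht h, Finset.mem_univ _⟩
  have hsub : {v | H.Reachable u v} ⊆
      ((Finset.univ : Finset (Option W)).biUnion fun o =>
        region (o.elim u (tipEmbedding K φ)) : Finset _) := by
    rintro v ⟨p⟩
    have key : ∀ {a b} (p : H.Walk a b) (o : Option W),
        (H ⊓ hostGraph π K).Reachable (o.elim u (tipEmbedding K φ)) a →
        ∃ o : Option W, (H ⊓ hostGraph π K).Reachable (o.elim u (tipEmbedding K φ)) b := by
      intro a b p
      induction p with
      | nil => exact fun o ho => ⟨o, ho⟩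
      | cons hadj p ih =>
        intro o ho
        rcases attachedGraph_adj_cases hH hadj with hQ | ⟨w, w', -, rfl, rfl⟩
        · exact ih o (ho.trans hQ.reachable)
        · exact ih (some w') .rfl
    obtain ⟨o, ho⟩ := key p none .rfl
    exact Finset.mem_coe.2 (Finset.mem_biUnion.2 ⟨o, Finset.mem_univ _, hreg _ _ ho⟩)
  refine (Set.ncard_le_ncard hsub (Finset.finite_toSet _)).trans ?_
  rw [Set.ncard_coe_finset]
  refine (Finset.card_biUnion_le_card_mul _ _ _ fun o _ => hcard _).trans ?_
  rw [Finset.card_univ, Fintype.card_option]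

end Attachment

/-! ### Degree bounds. -/

section Degrees

lemma ncard_hostGraph_neighborSet_le {Y : Type*} {π : Fin 8 → Equiv.Perm Y}
    {K : ℕ} (u : Y × Spider Letter K) :
    ((hostGraph π K).neighborSet u).ncard ≤ 17 * Fintype.card (Spider Letter K) := by
  classical
  have hsub : (hostGraph π K).neighborSet u ⊆
      ((Finset.univ.image fun σ : Letter => letterPerm π σ u.1) ×ˢ
        (Finset.univ : Finset (Spider Letter K)) : Finset _) := by
    intro v hv
    rw [Finset.mem_coe, Finset.mem_product]
    refine ⟨?_, Finset.mem_univ _⟩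
    obtain ⟨-, hX⟩ := (SimpleGraph.fromRel_adj _ _ _).1 (show (hostGraph π K).Adj u v from hv)
    rcases hX with (⟨τ, i, hi, -, rfl⟩ | ⟨τ, -, rfl⟩) | (⟨τ, i, hi, -, rfl⟩ | ⟨τ, h1, rfl⟩)
    · exact Finset.mem_image.2 ⟨none, Finset.mem_univ _, rfl⟩
    · exact Finset.mem_image_of_mem _ (Finset.mem_univ _)
    · exact Finset.mem_image.2 ⟨none, Finset.mem_univ _, rfl⟩
    · exact Finset.mem_image.2 ⟨τ.opp, Finset.mem_univ _, letterPerm_opp_apply π τ v.1⟩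
  refine (Set.ncard_le_ncard hsub (Finset.finite_toSet _)).trans ?_
  rw [Set.ncard_coe_finset, Finset.card_product, Finset.card_univ]
  refine Nat.mul_le_mul_right _ (Finset.card_image_le.trans ?_)
  simp [Finset.card_univ]

lemma ncard_treeGraph_neighborSet_le {N M L : ℕ} (u : Fin N × Spider (Fin M) L) :
    ((treeGraph N M L).neighborSet u).ncard ≤ 4 * Fintype.card (Spider (Fin M) L) := by
  classical
  set D : Finset ℕ := {u.1.val, u.1.val / 2, 2 * u.1.val, 2 * u.1.val + 1} with hD
  have hmaps : ∀ v ∈ (treeGraph N M L).neighborSet u, ((v.1 : ℕ), v.2) ∈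
      ((D ×ˢ (Finset.univ : Finset (Spider (Fin M) L)) : Finset _) :
        Set (ℕ × Spider (Fin M) L)) := by
    intro v hv
    rw [Finset.mem_coe, Finset.mem_product]
    refine ⟨?_, Finset.mem_univ _⟩
    obtain ⟨-, hX⟩ := (SimpleGraph.fromRel_adj _ _ _).1 (show (treeGraph N M L).Adj u v from hv)
    simp only [hD, Finset.mem_insert, Finset.mem_singleton]
    rcases hX with (⟨τ, i, hi, -, rfl⟩ | ⟨τ, -, rfl⟩) | (⟨τ, i, hi, -, rfl⟩ | ⟨τ, h1, rfl⟩)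
    · exact Or.inl rfl
    · exact Or.inr (Or.inl rfl)
    · exact Or.inl rfl
    · simp only [heapParent]
      omega
  refine (Set.ncard_le_ncard_of_injOn _ hmaps ?_ (Finset.finite_toSet _)).trans ?_
  · rintro ⟨x, b⟩ _ ⟨y, c⟩ _ h
    simp only [Prod.mk.injEq] at h
    exact Prod.ext (Fin.ext h.1) h.2
  · rw [Set.ncard_coe_finset, Finset.card_product, Finset.card_univ]
    exact Nat.mul_le_mul_right _ Finset.card_le_four

lemma ncard_attachedGraph_neighborSet_le {Y W : Type*} [Finite W] [Finite Y]
    {π : Fin 8 → Equiv.Perm Y} {K : ℕ} {T : SimpleGraph W} {φ : W ↪ Y} {d : ℕ}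
    (hd : ∀ w, (T.neighborSet w).ncard ≤ d) (u : Y × Spider Letter K) :
    ((attachedGraph π K T φ).neighborSet u).ncard ≤ 17 * Fintype.card (Spider Letter K) + d := by
  have h1 : (attachedGraph π K T φ).neighborSet u =
      (hostGraph π K).neighborSet u ∪ (T.map (tipEmbedding K φ)).neighborSet u := rfl
  rw [h1]
  refine (Set.ncard_union_le _ _).trans (add_le_add (ncard_hostGraph_neighborSet_le u) ?_)
  by_cases hu : ∃ w, u = tipEmbedding K φ w
  · obtain ⟨w, rfl⟩ := hu
    have h2 : (T.map (tipEmbedding K φ)).neighborSet (tipEmbedding K φ w) ⊆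
        tipEmbedding K φ '' T.neighborSet w := by
      intro v hv
      obtain ⟨a, b, h3, h4, h5⟩ := (SimpleGraph.map_adj _ _ _ _).1 hv
      rw [(tipEmbedding K φ).injective h4] at h3
      exact ⟨b, h3, h5⟩
    exact ((Set.ncard_le_ncard h2 (Set.toFinite _)).trans (Set.ncard_image_le (Set.toFinite _))).trans
      (hd w)
  · have h2 : (T.map (tipEmbedding K φ)).neighborSet u = ∅ := by
      ext v
      simp only [SimpleGraph.mem_neighborSet, Set.mem_empty_iff_false, iff_false]
      intro hv
      obtain ⟨a, b, -, h4, -⟩ := (SimpleGraph.map_adj _ _ _ _).1 hv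
      exact hu ⟨a, h4.symm⟩
    rw [h2]
    simp

end Degrees

/-! ### Transport to the vertex set `Fin n`. -/

section Relabelling
variable {V V' : Type*}

lemma le_diam_componentGraph [Finite V] {H : SimpleGraph V} {u v : V} {D : ℕ}
    (huv : H.Reachable u v) (h : ∀ p : H.Walk u v, D ≤ p.length) :
    D ≤ (componentGraph H u).diam := by
  set C := H.connectedComponentMk u
  have hu : u ∈ C := rfl
  have hv : v ∈ C := SimpleGraph.ConnectedComponent.sound huv.symm
  have hconn : (componentGraph H u).Connected := C.connected_toSimpleGraph
  have : Nonempty (H.connectedComponentMk u) := ⟨⟨u, hu⟩⟩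
  obtain ⟨p, hp⟩ := hconn.exists_walk_length_eq_dist ⟨u, hu⟩ ⟨v, hv⟩
  refine le_trans ?_ (SimpleGraph.dist_le_diam (u := ⟨u, hu⟩) (v := ⟨v, hv⟩)
    (SimpleGraph.connected_iff_ediam_ne_top.1 hconn))
  rw [← hp, ← SimpleGraph.Walk.length_map C.toSimpleGraph_hom p]
  exact h _

lemma diam_map_equiv_le (f : V ≃ V') {G : SimpleGraph V} {D : ℕ} (h : G.ediam ≤ D) :
    (G.map f).diam ≤ D := by
  have h1 : (G.map f).ediam ≤ D := by
    refine SimpleGraph.ediam_le_of_edist_le fun a b => ?_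
    obtain ⟨a, rfl⟩ := f.surjective a
    obtain ⟨b, rfl⟩ := f.surjective b
    have h2 : G.edist a b ≤ D := SimpleGraph.edist_le_ediam.trans h
    obtain ⟨p, hp⟩ := SimpleGraph.exists_walk_of_edist_ne_top
      (ne_top_of_le_ne_top (ENat.natCast_ne_top D) h2)
    rw [← hp] at h2
    refine le_trans ?_ h2
    have h3 := SimpleGraph.edist_le (p.map (SimpleGraph.Iso.map f G).toHom)
    rwa [SimpleGraph.Walk.length_map] at h3
  exact ENat.toNat_le_of_le_natCast h1

lemma isExpander_map_equiv [Fintype V] [Fintype V'] [DecidableEq V] [DecidableEq V'] (f : V ≃ V')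
    {G : SimpleGraph V} [DecidableRel G.Adj] {G' : SimpleGraph V'} [DecidableRel G'.Adj]
    (hG' : G' = G.map f) {c : ℕ} (hc : 0 < c)
    (h : ∀ S : Finset V, 2 * S.card ≤ Fintype.card V → S.card ≤ c * (G.interedges S Sᶜ).card) :
    IsExpander G' (1 / c) G'.maxDegree := by
  subst hG'
  refine ⟨rfl, fun S hS => ?_⟩
  have h1 := h (S.map f.symm.toEmbedding) (by
    rw [Finset.card_map, Fintype.card_congr f]
    have : (2 : ℝ) * S.card ≤ Fintype.card V' := by linarith
    exact_mod_cast this)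
  rw [Finset.card_map] at h1
  have h2 : (G.interedges (S.map f.symm.toEmbedding) (S.map f.symm.toEmbedding)ᶜ).card ≤
      ((G.map f).interedges S Sᶜ).card := by
    refine Finset.card_le_card_of_injOn (fun e => (f e.1, f e.2)) ?_ ?_
    · rintro ⟨a, b⟩ he
      rw [Finset.mem_coe, SimpleGraph.mem_interedges_iff] at he
      rw [Finset.mem_coe, SimpleGraph.mem_interedges_iff]
      obtain ⟨ha, hb, hab⟩ := he
      simp only [Finset.mem_compl, Finset.mem_map_equiv, Equiv.symm_symm] at ha hb ⊢
      exact ⟨ha, hb, (SimpleGraph.Iso.map f G).map_adj_iff.2 hab⟩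
    · rintro ⟨a, b⟩ _ ⟨a', b'⟩ _ hab
      simpa using hab
  have h3 : (S.card : ℝ) ≤ c * ((G.map f).interedges S Sᶜ).card := by
    exact_mod_cast h1.trans (Nat.mul_le_mul_left _ h2)
  rw [one_div, inv_mul_le_iff₀ (by exact_mod_cast hc)]
  exact h3

lemma maxDegree_map_equiv_le [Fintype V] [Fintype V'] (f : V ≃ V') {G : SimpleGraph V}
    {G' : SimpleGraph V'} [DecidableRel G'.Adj] (hG' : G' = G.map f) {d : ℕ}
    (h : ∀ v, (G.neighborSet v).ncard ≤ d) : G'.maxDegree ≤ d := by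
  subst hG'
  classical
  refine SimpleGraph.maxDegree_le_of_forall_degree_le _ _ fun v => ?_
  obtain ⟨v, rfl⟩ := f.surjective v
  have h1 := (SimpleGraph.Iso.map f G).degree_eq v
  refine le_trans (le_of_eq ?_) (h v)
  rw [← Nat.card_coe_set_eq, Nat.card_eq_fintype_card, SimpleGraph.card_neighborSet_eq_degree]
  exact h1

lemma le_diam_componentGraph_map [Finite V] [Finite V'] (f : V ≃ V') {H : SimpleGraph V} {u v : V}
    {D : ℕ} (huv : H.Reachable u v) (h : ∀ p : H.Walk u v, D ≤ p.length) :
    D ≤ (componentGraph (H.map f) (f u)).diam := by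
  have h' : ∀ u' v', u' = u → v' = v → ∀ p : H.Walk u' v', D ≤ p.length := by
    rintro _ _ rfl rfl
    exact h
  refine le_diam_componentGraph (huv.map (SimpleGraph.Iso.map f H).toHom) fun p => ?_
  have h1 := h' _ _ (f.symm_apply_apply u) (f.symm_apply_apply v)
    (p.map (SimpleGraph.Iso.map f H).symm.toHom)
  exact h1.trans_eq (SimpleGraph.Walk.length_map _ p)

lemma ncard_component_map_le [Finite V] (f : V ≃ V') {H : SimpleGraph V} {s : ℕ}
    (h : ∀ u, {v | H.Reachable u v}.ncard ≤ s) (C : (H.map f).ConnectedComponent) :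
    C.supp.ncard ≤ s := by
  induction C using SimpleGraph.ConnectedComponent.ind with | _ u
  obtain ⟨u, rfl⟩ := f.surjective u
  refine le_trans ?_ (h u)
  have hsub : ((H.map f).connectedComponentMk (f u)).supp ⊆ f '' {v | H.Reachable u v} := by
    intro v hv
    obtain ⟨v, rfl⟩ := f.surjective v
    refine ⟨v, ?_, rfl⟩
    have h1 : (H.map f).Reachable (f v) (f u) := SimpleGraph.ConnectedComponent.exact hv
    exact ((SimpleGraph.Iso.map f H).reachable_iff.1 h1).symm
  exact (Set.ncard_le_ncard hsub (Set.toFinite _)).trans (Set.ncard_image_le (Set.toFinite _))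

end Relabelling

/-! ### Choice of parameters and conclusion. -/

section Assembly

lemma percolation_real_le_of_subset {V : Type*} [Finite V] (G : SimpleGraph V) (p : unitInterval)
    {A B C : Set (SimpleGraph V)} (h : ∀ H ∈ A, H ≤ G → H ∉ B → H ∈ C) :
    (percolation G p).real A - (percolation G p).real B ≤ (percolation G p).real C := by
  have h0 : (percolation G p).real {H | ¬ H ≤ G} = 0 := by
    rw [measureReal_eq_zero_iff]
    exact percolation_ae_le G p
  have hsub : A ⊆ C ∪ (B ∪ {H | ¬ H ≤ G}) := by
    intro H hH
    by_cases h1 : H ≤ G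
    · by_cases h2 : H ∈ B
      · exact Or.inr (Or.inl h2)
      · exact Or.inl (h H hH h1 h2)
    · exact Or.inr (Or.inr h1)
  have h1 := measureReal_mono (μ := percolation G p) hsub
  have h2 := measureReal_union_le (μ := percolation G p) C (B ∪ {H | ¬ H ≤ G})
  have h3 := measureReal_union_le (μ := percolation G p) B {H | ¬ H ≤ G}
  linarith

/-- The arithmetic behind the choice of the size of the tree and of the base expander. -/
lemma attachment_size_le {t w β : ℕ} (ht : (2 * w + 1) * (17 * β) ≤ 17 ^ t) :
    (2 ^ (t + 1) * w + 1) * (17 ^ (t + 1) * β) ≤ 17 ^ (3 * t) := by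
  have h2 : 2 ^ (t + 1) * w + 1 ≤ 17 ^ t * (2 * w + 1) := by
    have h3 : 2 ^ t ≤ 17 ^ t := Nat.pow_le_pow_left (by norm_num) t
    have h4 : 1 ≤ 17 ^ t := Nat.one_le_pow _ _ (by norm_num)
    rw [pow_succ]
    nlinarith [Nat.mul_le_mul_right (2 * w) h3]
  calc (2 ^ (t + 1) * w + 1) * (17 ^ (t + 1) * β)
      ≤ 17 ^ t * (2 * w + 1) * (17 ^ (t + 1) * β) := Nat.mul_le_mul_right _ h2
    _ = 17 ^ t * 17 ^ t * ((2 * w + 1) * (17 * β)) := by rw [pow_succ]; ring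
    _ ≤ 17 ^ t * 17 ^ t * 17 ^ t := Nat.mul_le_mul_left _ ht
    _ = 17 ^ (3 * t) := by rw [mul_comm 3 t, pow_mul]; ring

-- The constants are fixed in the order K, L, M, before t, so degree and expansion do not depend on
-- t. Outside the event of a bad path, both the distance bound and the component bound are
-- deterministic.
open Classical in
lemma exists_percolated_expanders {ε : ℝ} (hε : 0 < ε) {p : unitInterval} (hp0 : 0 < p)
    (hp1 : p < 1) :
    ∃ c d β t₀ : ℕ, 0 < c ∧ 0 < β ∧ ∀ t, t₀ ≤ t →
      ∃ (G : SimpleGraph (Fin (17 ^ (6 * t) * β))) (v : Fin (17 ^ (6 * t) * β)),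
        IsExpander G (1 / c) G.maxDegree ∧ G.maxDegree ≤ d ∧
        1 - ε ≤ (percolation G p).real
          {H | (1 - ε) * (G.diam : ℝ) ≤ ((componentGraph H v).diam : ℝ)} ∧
        1 - (1 / 17) ^ t ≤ (percolation G p).real {H | ∀ C : H.ConnectedComponent,
          (C.supp.ncard : ℝ) ≤ ((17 ^ (6 * t) * β : ℕ) : ℝ) ^ (1 - 1 / 2 : ℝ)} := by
  have hp0' : (0 : ℝ) < p := hp0
  have hp1' : (p : ℝ) < 1 := hp1
  -- The seventh power beats the 17^(6t) starting points and leaves 17^(-t).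
  obtain ⟨K, hK⟩ : ∃ K : ℕ, (p : ℝ) ^ K < 1 / (17 * 17 * 17 ^ 7) :=
    exists_pow_lt_of_lt_one (by positivity) hp1'
  have hK' : (17 * 17 * (p : ℝ) ^ (K + 1)) ≤ (1 / 17) ^ 7 := by
    have h1 : (p : ℝ) ^ (K + 1) ≤ (p : ℝ) ^ K := pow_le_pow_of_le_one hp0'.le hp1'.le (Nat.le_succ K)
    calc (17 * 17 * (p : ℝ) ^ (K + 1)) ≤ 17 * 17 * (1 / (17 * 17 * 17 ^ 7)) := by
          gcongr; exact h1.trans hK.le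
      _ = _ := by norm_num
  -- With balls of radius 186t the diameter is at most 2(186t+1)(2K+3) ≤ 374t(2K+3), using t ≥ 1.
  obtain ⟨L, hL⟩ : ∃ L : ℕ, L = 374 * (2 * K + 3) := ⟨_, rfl⟩
  set e : ℝ := min (ε / 2) (1 / 4) with he
  have he0 : 0 < e := lt_min (by linarith) (by norm_num)
  have hpL : (0 : ℝ) < (p : ℝ) ^ (L + 2) := by positivity
  obtain ⟨M, hM⟩ : ∃ M : ℕ, (1 - (p : ℝ) ^ (L + 2)) ^ M < e :=
    exists_pow_lt_of_lt_one he0 (by linarith)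
  set β := Fintype.card (Spider Letter K) with hβ
  set w := Fintype.card (Spider (Fin M) L) with hw
  obtain ⟨t₁, ht₁⟩ : ∃ t₁ : ℕ, (1 / 17 : ℝ) ^ t₁ < ε / 2 :=
    exists_pow_lt_of_lt_one (by linarith) (by norm_num)
  obtain ⟨t₂, ht₂⟩ : ∃ t₂ : ℕ, (2 * w + 1) * (17 * β) < 17 ^ t₂ :=
    pow_unbounded_of_one_lt _ (by norm_num)
  have hβ0 : 0 < β := Fintype.card_pos
  refine ⟨11 * β, 17 * β + 4 * w, β, max 1 (max t₁ t₂), by positivity, hβ0, fun t ht => ?_⟩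
  have ht1 : 1 ≤ t := (le_max_left _ _).trans ht
  have htt₁ : t₁ ≤ t := (le_max_left _ _).trans ((le_max_right _ _).trans ht)
  have htt₂ : t₂ ≤ t := (le_max_right _ _).trans ((le_max_right _ _).trans ht)
  have hsize : (2 ^ (t + 1) * w + 1) * (17 ^ (t + 1) * β) ≤ 17 ^ (3 * t) :=
    attachment_size_le (ht₂.le.trans (Nat.pow_le_pow_right (by norm_num) htt₂))
  have hWcard : Fintype.card (Fin (2 ^ (t + 1)) × Spider (Fin M) L) = 2 ^ (t + 1) * w := by
    rw [Fintype.card_prod, Fintype.card_fin]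
  obtain ⟨π, hπ⟩ := exists_expanding_perms (Fin (17 ^ (6 * t)))
  have hπ : Expanding π := fun S hS => by
    convert hπ S hS
  obtain ⟨φ₀, hφ₀⟩ := exists_wordSeparated π (W := Fin (2 ^ (t + 1)) × Spider (Fin M) L)
    (r := t + 1) (by
      rw [hWcard, Fintype.card_fin]
      calc 2 ^ (t + 1) * w * 17 ^ (t + 1) ≤ (2 ^ (t + 1) * w + 1) * (17 ^ (t + 1) * β) :=
            Nat.mul_le_mul (Nat.le_succ _) (Nat.le_mul_of_pos_right _ hβ0)
        _ ≤ 17 ^ (3 * t) := hsize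
        _ ≤ 17 ^ (6 * t) := Nat.pow_le_pow_right (by norm_num) (by omega))
  set φ : Fin (2 ^ (t + 1)) × Spider (Fin M) L ↪ Fin (17 ^ (6 * t)) := ⟨φ₀, hφ₀.injective⟩
  have hφ : WordSeparated π φ (t + 1) := hφ₀
  set T := treeGraph (2 ^ (t + 1)) M L with hT
  set G := attachedGraph π K T φ with hG
  have hhost : hostGraph π K ≤ G := le_sup_left
  have f : Fin (17 ^ (6 * t)) × Spider Letter K ≃ Fin (17 ^ (6 * t) * β) :=
    Fintype.equivFinOfCardEq (by rw [Fintype.card_prod, Fintype.card_fin])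
  have hroot : 1 < 2 ^ (t + 1) := Nat.one_lt_two_pow (by omega)
  set root : Fin (2 ^ (t + 1)) := ⟨1, hroot⟩ with hrootdef
  have hbad : (percolation G p).real {H | HasBadPath π H t} ≤ (1 / 17) ^ t := by
    refine (measureReal_hasBadPath_le π G hhost p ht1).trans ?_
    rw [Fintype.card_fin]
    calc ((17 ^ (6 * t) : ℕ) : ℝ) * (17 * 17 * (p : ℝ) ^ (K + 1)) ^ t
        ≤ ((17 ^ (6 * t) : ℕ) : ℝ) * ((1 / 17) ^ 7) ^ t := by gcongr
      _ = (1 / 17) ^ t := by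
          push_cast
          rw [pow_mul, ← mul_pow]
          norm_num
  have hdiam : (G.map f).diam ≤ L * t := by
    refine diam_map_equiv_le f ((SimpleGraph.ediam_anti hhost).trans
      ((hostGraph_ediam_le hπ (r := 186 * t) ?_).trans ?_))
    -- The radius works because 10^31 · 17 < 11^31.
    · rw [Fintype.card_fin, show 186 * t = 31 * (6 * t) by ring, pow_mul 10,
        pow_mul 11, ← mul_pow]
      exact Nat.pow_lt_pow_left (by norm_num) (by omega)
    · refine Nat.cast_le.2 ?_
      calc 2 * (186 * t + 1) * (2 * K + 3) ≤ 374 * t * (2 * K + 3) :=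
            Nat.mul_le_mul_right _ (by omega)
        _ = L * t := by rw [hL]; ring
  obtain ⟨G', hG'⟩ : ∃ G', G' = G.map f := ⟨_, rfl⟩
  refine ⟨G', f (tipEmbedding K φ (root, none)), ?_, ?_, ?_, ?_⟩
  · refine isExpander_map_equiv f hG' (by positivity) fun S hS => ?_
    exact hostGraph_expansion hπ G hhost S hS
  · exact maxDegree_map_equiv_le f hG' (ncard_attachedGraph_neighborSet_le
      fun w => ncard_treeGraph_neighborSet_le w)
  · subst hG'
    have hreach := le_measureReal_reach_top G p (tipEmbedding K φ) (le_sup_right) he0.le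
      (min_le_right _ _) hM.le root rfl
    have h1 : (1 / 17 : ℝ) ^ t ≤ (1 / 17 : ℝ) ^ t₁ :=
      pow_le_pow_of_le_one (by norm_num) (by norm_num) htt₁
    have h2 : e ≤ ε / 2 := min_le_left _ _
    refine le_trans ?_ ((percolation_real_le_of_subset G p
      (A := {H | ∃ y : Fin (2 ^ (t + 1)), Nat.log 2 y = t ∧
        H.Reachable (tipEmbedding K φ (root, none)) (tipEmbedding K φ (y, none))})
      (B := {H | HasBadPath π H t}) ?_).trans_eq (percolation_real_map_equiv f G p _).symm)
    · linarith
    · rintro H ⟨y, hy, hr⟩ hH hHbad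
      have h3 : (L + 2) * t ≤ (componentGraph (H.map f) (f (tipEmbedding K φ (root, none)))).diam := by
        refine le_diam_componentGraph_map f hr fun q => ?_
        have h4 := level_le_of_walk hH hHbad hφ treeLevel
          (fun a b hab => treeLevel_le_of_adj hab.symm) q
        simpa [treeLevel, hrootdef, spiderPos, hy] using h4
      -- On the good event the component has at least the full diameter of the graph; the factor 1 -
      -- ε is not used up.
      have h5 : ((G.map f).diam : ℝ) ≤ (componentGraph (H.map f)
          (f (tipEmbedding K φ (root, none)))).diam := by
        exact_mod_cast hdiam.trans ((Nat.mul_le_mul_right t (by omega)).trans h3)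
      refine le_trans ?_ h5
      nlinarith [Nat.cast_nonneg (α := ℝ) (G.map f).diam]
  · rw [hG', percolation_real_map_equiv f]
    refine le_trans ?_ (percolation_real_le_of_subset G p (A := Set.univ)
      (B := {H | HasBadPath π H t}) ?_)
    · rw [probReal_univ]
      linarith
    · intro H _ hH hHbad C
      have h1 := ncard_component_map_le f (ncard_reachable_le hH hHbad) C
      rw [hWcard] at h1
      have h2 : (C.supp.ncard : ℝ) ≤ (17 : ℝ) ^ (3 * t) := by
        exact_mod_cast h1.trans hsize
      refine h2.trans ?_
      rw [show (1 - 1 / 2 : ℝ) = 1 / 2 by norm_num, ← Real.sqrt_eq_rpow]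
      refine Real.le_sqrt_of_sq_le ?_
      push_cast
      rw [← pow_mul, show 3 * t * 2 = 6 * t by ring]
      have : (1 : ℝ) ≤ β := by exact_mod_cast hβ0
      exact le_mul_of_one_le_right (by positivity) this

end Assembly

open Classical in
theorem theorem3 (ε : ℝ) (hε : 0 < ε) (p : unitInterval) (hp0 : 0 < p) (hp1 : p < 1) :
    ∃ (b : ℝ) (d : ℕ) (δ : ℝ), 0 < b ∧ 0 < d ∧ 0 < δ ∧
      ∃ (n : ℕ → ℕ) (G : ∀ k, SimpleGraph (Fin (n k))) (v : ∀ k, Fin (n k)),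
        StrictMono n ∧
        (∀ k, IsExpander (G k) b d) ∧
        (∀ k, 1 - ε ≤ (percolation (G k) p).real
          {H | (1 - ε) * ((G k).diam : ℝ) ≤ ((componentGraph H (v k)).diam : ℝ)}) ∧
        Tendsto (fun k => (percolation (G k) p).real
            {H | ∀ C : H.ConnectedComponent, (C.supp.ncard : ℝ) ≤ (n k : ℝ) ^ (1 - δ)})
          atTop (𝓝 1) := by
  obtain ⟨c, D, β, t₀, hc, hβ, hstage⟩ := exists_percolated_expanders hε hp0 hp1
  choose G v hG hD hdiam hcomp using fun k => hstage (t₀ + k) (Nat.le_add_right _ _)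
  -- The maximum degree is only known to be bounded, while an expander must have it equal to d; by
  -- pigeonhole some value recurs infinitely often, and the sequence is thinned to it.
  obtain ⟨d, -, hd⟩ : ∃ d ∈ Set.Iic D, ∃ᶠ k in atTop, (G k).maxDegree = d := by
    by_contra hcon
    push Not at hcon
    have h1 : ∀ᶠ k in atTop, ∀ d ∈ Set.Iic D, (G k).maxDegree ≠ d :=
      (eventually_all_finite (Set.finite_Iic D)).2 hcon
    obtain ⟨k, hk⟩ := h1.exists
    exact hk _ (hD k) rfl
  obtain ⟨ψ, hψ, hψd⟩ := extraction_of_frequently_atTop hd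
  -- Expansion of a single vertex, applicable once n ≥ 2, forces an edge.
  have hpos : 0 < d := by
    have hψ1 : 1 ≤ ψ 1 := hψ.id_le 1
    have hn : 2 ≤ 17 ^ (6 * (t₀ + ψ 1)) * β := by
      have : 17 ^ 1 ≤ 17 ^ (6 * (t₀ + ψ 1)) := Nat.pow_le_pow_right (by norm_num) (by omega)
      nlinarith
    have h1 := (hG (ψ 1)).2 {v (ψ 1)} (by
      rw [Finset.card_singleton, Fintype.card_fin, le_div_iff₀ (by norm_num)]
      exact_mod_cast hn)
    have h2 : 0 < ((G (ψ 1)).interedges {v (ψ 1)} {v (ψ 1)}ᶜ).card := by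
      have h3 : (0 : ℝ) < 1 / c * (({v (ψ 1)} : Finset (Fin _)).card : ℝ) := by
        rw [Finset.card_singleton]; positivity
      exact_mod_cast h3.trans_le h1
    obtain ⟨⟨a, b⟩, hab⟩ := Finset.card_pos.1 h2
    rw [SimpleGraph.mem_interedges_iff] at hab
    rw [← hψd 1]
    refine lt_of_lt_of_le ?_ ((G (ψ 1)).degree_le_maxDegree a)
    exact ((G (ψ 1)).degree_pos_iff_exists_adj a).2 ⟨b, hab.2.2⟩
  refine ⟨1 / c, d, 1 / 2, by positivity, hpos, by norm_num,
    fun k => 17 ^ (6 * (t₀ + ψ k)) * β, fun k => G (ψ k), fun k => v (ψ k), ?_, ?_, ?_, ?_⟩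
  · intro i j hij
    refine Nat.mul_lt_mul_of_pos_right (Nat.pow_lt_pow_right (by norm_num) ?_) hβ
    have := hψ hij
    omega
  · intro k
    have := hG (ψ k)
    rwa [hψd k] at this
  · exact fun k => hdiam (ψ k)
  · refine tendsto_of_tendsto_of_tendsto_of_le_of_le (g := fun k => 1 - (1 / 17 : ℝ) ^ (t₀ + ψ k))
      ?_ tendsto_const_nhds (fun k => hcomp (ψ k)) (fun k => measureReal_le_one)
    have h1 : Tendsto (fun k => t₀ + ψ k) atTop atTop :=
      tendsto_atTop_mono (fun k => Nat.le_add_left _ _) hψ.tendsto_atTop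
    have h2 : Tendsto (fun k => (1 / 17 : ℝ) ^ (t₀ + ψ k)) atTop (𝓝 0) :=
      (tendsto_pow_atTop_nhds_zero_of_lt_one (by norm_num) (by norm_num)).comp h1
    simpa using (tendsto_const_nhds : Tendsto (fun _ : ℕ => (1 : ℝ)) atTop (𝓝 1)).sub h2
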